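/- **Conventions.** For $f\in L^2(\mathbb R^d)$ let $\hat f(\xi)=\int f(x)e^{-ix\cdot\xi}\,dx$ (extended to $L^2$ by Plancherel). For integers $0\le l<N$ put $P_{N,l}(x)=\sum_{j=0}^{l}\binom{N-1+j}{j}x^j$. A *mask of a pseudo-spline of type I with order $(N,l)$* is a trigonometric polynomial $\hat a(\xi)=\sum_{n\in\mathbb Z}a(n)e^{-in\xi}$ with finitely many non-zero coefficients, all real, such that $$|\hat a(\xi)|^2=\cos^{2N}(\xi/2)\,P_{N,l}(\sin^2(\xi/2))\quad(\xi\in\mathbb R),\qquad \hat a(0)=1 .$$ Its associated refinable function $\phi$ is given by $\hat\phi(\xi)=\prod_{j=1}^{\infty}\hat a(2^{-j}\xi)$. For $j\ge 0$ and $k\in\mathbb Z$ let $A_{2^j}=\begin{pmatrix}2^j&0\\0&2^{j/2}\end{pmatrix}$ and $S_k=\begin{pmatrix}1&k\\0&1\end{pmatrix}$. For $\psi\in L^2(\mathbb R^2)$ and $c=(c_1,c_2)$ with $c_1,c_2>0$ let $\Psi(\psi;c)$ be the family $$2^{\frac34 j}\,\psi\big(S_kA_{2^j}x-(c_1m_1,c_2m_2)\big),\qquad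 j\ge 0,\ |k|\le\lceil 2^{j/2}\rceil,\ m\in\mathbb Z^2 .$$ For $\alpha>0$ let $\mathcal C_1(\alpha)=\{\xi\in\mathbb R^2:\xi_1\ge\alpha,\ |\xi_2/\xi_1|\le 1\}$ and $\mathcal C_3(\alpha)=\{\xi\in\mathbb R^2:\xi_1\le-\alpha,\ |\xi_2/\xi_1|\le 1\}$. A family $(\sigma_i)_{i\in I}$ in $L^2(\mathbb R^2)$ is called a *frame for* a set $H\subseteq L^2(\mathbb R^2)$ if there are constants $A,B>0$ with $A\|f\|_2^2\le\sum_{i\in I}|\langle f,\sigma_i\rangle|^2\le B\|f\|_2^2$ for all $f\in H$. **Theorem.** Let $0\le l_1<N_1$ and $0\le l_2<N_2$ be integers such that $N_1>N_2>3$ if $l_2=0$, and $N_1\ge N_2>8$ if $l_2>0$. Let $\widehat{a_{N_1,l_1}}$ and $\widehat{a_{N_2,l_2}}$ be masks of pseudo-splines of type I with orders $(N_1,l_1)$ and $(N_2,l_2)$, let $\phi$ be the refinable function associated with $\widehat{a_{N_2,l_2}}$, and put $\hat b(\xi)=e^{-i\xi}\,\overline{\widehat{a_{N_1,l_1}}(\xi+\pi)}$.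 Then there is exactly one $\psi\in L^2(\mathbb R^2)$ with $$\hat\psi(2\xi)=\hat b(\xi_1)\,\hat\phi(\xi_1)\,\hat\phi(\xi_2)\qquad\text{for almost every }\xi=(\xi_1,\xi_2)\in\mathbb R^2,$$ and for every $\alpha\in(0,\pi/2)$ there is a constant $\hat c>0$ such that for all $c=(c_1,c_2)$ with $0<c_2\le c_1\le\hat c$ the shearlet system $\Psi(\psi;c)$ is a frame for $$\{f\in L^2(\mathbb R^2):\operatorname{supp}\hat f\subseteq\mathcal C_1(\alpha)\cup\mathcal C_3(\alpha)\}.$$ -/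

import Mathlib

open MeasureTheory FourierTransform

noncomputable section

namespace Shearlet

/-! ### The plane, `L²(ℝ²)` and the Fourier transform -/

/-- The Euclidean plane `ℝ²`. -/
abbrev Plane : Type := EuclideanSpace ℝ (Fin 2)

/-- The complex Hilbert space `L²(ℝ²)`. -/
abbrev L2Plane : Type := Lp (α := Plane) ℂ 2 volume

/-- The Fourier transform on `L²(ℝ²)` in the normalization
`f̂(ξ) = ∫ f(x) exp(-i x·ξ) dx`.  Mathlib's unitary `𝓕` on `L²` uses the kernel
`exp(-2πi x·ξ)`, so `f̂(ξ) = (𝓕 f)(ξ / 2π)`. It is determined up to null sets. -/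
def hat (f : L2Plane) (ξ : Plane) : ℂ :=
  (𝓕 f : L2Plane) ((2 * Real.pi)⁻¹ • ξ)

/-! ### Masks, pseudo-splines of type I and the refinable function -/

/-- The trigonometric polynomial `â(ξ) = ∑ₙ a(n) exp(-i n ξ)` with finitely many real
coefficients `a(n)`, `n ∈ ℤ`. -/
def symbol (a : ℤ →₀ ℝ) (ξ : ℝ) : ℂ :=
  a.sum fun n c => (c : ℂ) * Complex.exp (-Complex.I * n * ξ)

/-- The polynomial `P_{N,l}(x) = ∑_{j=0}^{l} binom(N-1+j, j) x^j` (used for `N ≥ 1`). -/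
def pseudoSplinePoly (N l : ℕ) (x : ℝ) : ℝ :=
  ∑ j ∈ Finset.range (l + 1), ((N - 1 + j).choose j : ℝ) * x ^ j

/-- The mask of the pseudo-spline of type II with order `(N, l)`:
`cos^{2N}(ξ/2) P_{N,l}(sin²(ξ/2))`. -/
def maskTypeII (N l : ℕ) (ξ : ℝ) : ℝ :=
  Real.cos (ξ / 2) ^ (2 * N) * pseudoSplinePoly N l (Real.sin (ξ / 2) ^ 2)

/-- `a` is (the coefficient sequence of) a mask of a pseudo-spline of type I with order `(N, l)`:
a trigonometric polynomial with real coefficients which is a square root, in the sense of the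
Riesz lemma, of the type II mask, `|â(ξ)|² = cos^{2N}(ξ/2) P_{N,l}(sin²(ξ/2))`. The normalization
`â(0) = 1` fixes the sign of the square root (`|â(0)|² = 1` holds automatically); with the other
sign the infinite product of the refinable function does not converge. -/
structure IsTypeIMask (N l : ℕ) (a : ℤ →₀ ℝ) : Prop where
  norm_sq_eq : ∀ ξ : ℝ, ‖symbol a ξ‖ ^ 2 = maskTypeII N l ξ
  symbol_zero : symbol a 0 = 1

/-- The Fourier transform `φ̂(ξ) = ∏_{j ≥ 1} â(2^{-j} ξ)` of the refinable function with
mask `â`. -/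
def refinableHat (a : ℤ →₀ ℝ) (ξ : ℝ) : ℂ :=
  ∏' j : ℕ, symbol a (ξ / 2 ^ (j + 1))

/-- The infinite product defining `φ̂` converges for every mask with `â(0) = 1`. -/
theorem multipliable_refinableHat (a : ℤ →₀ ℝ) (h0 : symbol a 0 = 1) (ξ : ℝ) :
    Multipliable fun j : ℕ => symbol a (ξ / 2 ^ (j + 1)) := by
  have key : ∀ x : ℝ, ‖symbol a x - 1‖ ≤ (∑ n ∈ a.support, |a n| * |(n : ℝ)|) * |x| := by
    intro x
    rw [← h0]
    simp only [symbol, Finsupp.sum]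
    rw [← Finset.sum_sub_distrib, Finset.sum_mul]
    refine (norm_sum_le _ _).trans ?_
    refine Finset.sum_le_sum fun n _ => ?_
    rw [← mul_sub, norm_mul, Complex.norm_real, Real.norm_eq_abs, mul_assoc |a n|]
    refine mul_le_mul_of_nonneg_left ?_ (abs_nonneg (a n))
    have h := Real.norm_exp_I_mul_ofReal_sub_one_le (x := -((n : ℝ) * x))
    have e0 : Complex.exp (-Complex.I * n * ((0 : ℝ) : ℂ)) = 1 := by simp
    have e : -Complex.I * n * x = Complex.I * ((-((n : ℝ) * x) : ℝ) : ℂ) := by push_cast; ring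
    rw [e, e0]
    simpa [abs_mul] using h
  have hs : Summable fun j : ℕ => ‖symbol a (ξ / 2 ^ (j + 1)) - 1‖ := by
    refine Summable.of_nonneg_of_le (fun _ => norm_nonneg _) (fun j => key _) ?_
    refine Summable.mul_left _ ?_
    have : (fun j : ℕ => |ξ / 2 ^ (j + 1)|) = fun j : ℕ => (|ξ| / 2) * (1 / 2 : ℝ) ^ j := by
      funext j
      rw [abs_div, abs_of_pos (by positivity : (0 : ℝ) < 2 ^ (j + 1)), pow_succ, one_div, inv_pow]
      field_simp
    rw [this]
    exact (summable_geometric_of_lt_one (by norm_num) (by norm_num)).mul_left _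
  have := multipliable_one_add_of_summable hs
  simpa using this

/-- `b̂(ξ) = exp(-iξ) · conj (â(ξ + π))`. -/
def highPass (a : ℤ →₀ ℝ) (ξ : ℝ) : ℂ :=
  Complex.exp (-Complex.I * ξ) * (starRingEnd ℂ) (symbol a (ξ + Real.pi))

/-- `ψ ∈ L²(ℝ²)` is the shearlet built from the masks `â₁`, `â₂`:
`ψ̂(2ξ) = b̂(ξ₁) φ̂(ξ₁) φ̂(ξ₂)` for almost every `ξ`, where `b̂` comes from `â₁` and `φ` is the
refinable function with mask `â₂`. -/
def IsShearlet (a₁ a₂ : ℤ →₀ ℝ) (ψ : L2Plane) : Prop :=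
  ∀ᵐ ξ : Plane, hat ψ ((2 : ℝ) • ξ) =
    highPass a₁ (ξ 0) * refinableHat a₂ (ξ 0) * refinableHat a₂ (ξ 1)

/-! ### Shearlet systems -/

/-- The parabolic scaling matrix `A_{2^j} = diag(2^j, 2^{j/2})`. -/
def scaleMat (j : ℕ) : Matrix (Fin 2) (Fin 2) ℝ :=
  !![(2 : ℝ) ^ j, 0; 0, (2 : ℝ) ^ ((j : ℝ) / 2)]

/-- The shear matrix `S_k = (1 k; 0 1)`. -/
def shearMat (k : ℤ) : Matrix (Fin 2) (Fin 2) ℝ :=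
  !![1, (k : ℝ); 0, 1]

/-- The affine map `x ↦ S_k A_{2^j} x - (c₁ m₁, c₂ m₂)` of the plane. -/
def shearAffine (c₁ c₂ : ℝ) (j : ℕ) (k : ℤ) (m : ℤ × ℤ) (x : Plane) : Plane :=
  Matrix.toEuclideanLin (shearMat k * scaleMat j) x - !₂[c₁ * m.1, c₂ * m.2]

/-- The function `2^{3j/4} ψ(S_k A_{2^j} x - (c₁ m₁, c₂ m₂))`. -/
def shearletFun (ψ : L2Plane) (c₁ c₂ : ℝ) (j : ℕ) (k : ℤ) (m : ℤ × ℤ) (x : Plane) : ℂ :=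
  (((2 : ℝ) ^ (3 * (j : ℝ) / 4) : ℝ) : ℂ) * ψ (shearAffine c₁ c₂ j k m x)

theorem memLp_shearletFun (ψ : L2Plane) (c₁ c₂ : ℝ) (j : ℕ) (k : ℤ) (m : ℤ × ℤ) :
    MemLp (shearletFun ψ c₁ c₂ j k m) 2 volume := by
  refine MemLp.const_mul ?_ _
  set v : Plane := !₂[c₁ * m.1, c₂ * m.2]
  set L : Plane →ₗ[ℝ] Plane := Matrix.toEuclideanLin (shearMat k * scaleMat j) with hL
  have hdet : LinearMap.det L ≠ 0 := by
    have h1 : LinearMap.det L = (shearMat k * scaleMat j).det := by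
      rw [hL]
      change LinearMap.det (Matrix.toLpLin 2 2 (shearMat k * scaleMat j)) = _
      rw [Matrix.toLpLin_eq_toLin, LinearMap.det_toLin]
    rw [h1, Matrix.det_mul]
    simp only [shearMat, scaleMat, Matrix.det_fin_two_of]
    have : (0 : ℝ) < (2 : ℝ) ^ ((j : ℝ) / 2) := by positivity
    simp [this.ne']
  have hψ : MemLp (fun y : Plane => ψ (y - v)) 2 volume :=
    (Lp.memLp ψ).comp_measurePreserving (measurePreserving_sub_right volume v)
  have hmap := Measure.map_linearMap_addHaar_eq_smul_addHaar (volume : Measure Plane) hdet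
  have hψ' : MemLp (fun y : Plane => ψ (y - v)) 2 (Measure.map L volume) := by
    rw [hmap]
    exact hψ.smul_measure ENNReal.ofReal_ne_top
  exact hψ'.comp_of_map L.continuous_of_finiteDimensional.measurable.aemeasurable

/-- The index set of the system: `j ≥ 0`, `|k| ≤ ⌈2^{j/2}⌉`, `m ∈ ℤ²`. -/
def ShearIndex : Type :=
  {p : ℕ × ℤ × (ℤ × ℤ) // |p.2.1| ≤ ⌈(2 : ℝ) ^ ((p.1 : ℝ) / 2)⌉}

/-- The shearlet system `Ψ(ψ; c)`, a family in `L²(ℝ²)`. -/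
def shearletSystem (ψ : L2Plane) (c₁ c₂ : ℝ) (i : ShearIndex) : L2Plane :=
  (memLp_shearletFun ψ c₁ c₂ i.1.1 i.1.2.1 i.1.2.2).toLp _

/-! ### Cones and frames -/

/-- The horizontal cones `C₁(α) ∪ C₃(α)`: `|ξ₂| ≤ |ξ₁|` and `ξ₁ ≥ α`, respectively
`ξ₁ ≤ -α`. -/
def horizontalCones (α : ℝ) : Set Plane :=
  {ξ | α ≤ ξ 0 ∧ |ξ 1 / ξ 0| ≤ 1} ∪ {ξ | ξ 0 ≤ -α ∧ |ξ 1 / ξ 0| ≤ 1}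

/-- The functions `f ∈ L²(ℝ²)` with `supp f̂ ⊆ C₁(α) ∪ C₃(α)`. The cones form a closed set, so the
(essential) support of `f̂` lies in it iff `f̂` vanishes almost everywhere outside it. -/
def coneSpace (α : ℝ) : Set L2Plane :=
  {f | ∀ᵐ ξ : Plane, ξ ∉ horizontalCones α → hat f ξ = 0}

/-- The family `σ` is a frame for the functions in `H`: there are `0 < A`, `0 < B` with
`A ‖f‖² ≤ ∑ᵢ |⟨f, σᵢ⟩|² ≤ B ‖f‖²` for all `f ∈ H`, the sum being convergent. -/
def IsFrameFor {ι : Type*} (H : Set L2Plane) (σ : ι → L2Plane) : Prop :=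
  ∃ A B : ℝ, 0 < A ∧ 0 < B ∧ ∀ f ∈ H,
    Summable (fun i => ‖inner ℂ f (σ i)‖ ^ 2) ∧
    A * ‖f‖ ^ 2 ≤ ∑' i, ‖inner ℂ f (σ i)‖ ^ 2 ∧
    ∑' i, ‖inner ℂ f (σ i)‖ ^ 2 ≤ B * ‖f‖ ^ 2

end Shearlet

end

open Filter Topology

noncomputable section

namespace Shearlet

/-! In the unitary normalization the shearlet has Fourier transform $G(x,y)=\hat b(\pi
x)\hat\phi(\pi x)\hat\phi(\pi y)$, and three properties of $G$ suffice. It decays like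
$(1+|x|)^{-5/4}(1+|y|)^{-5/4}$; it vanishes to third order at $x=0$; and it is bounded below where
$|x|,|y|\le 1$ and $|x|$ stays away from $0$. The decay comes from the telescoping product of
cosines and the estimate $P_{N,l}(1)\le\frac{5}{32}4^N$, the zero from $|\hat
b(\xi)|\lesssim|\sin(\xi/2)|^{N_1}$, the lower bound from $|\hat a(\xi)|\ge|\cos(\xi/2)|^N$
(`exists_norm_shearletHat_le`, `norm_shearletHat_ge`). Existence and uniqueness of $\psi$ follow
from Plancherel, since $G\in L^2$.

For a fixed scale and shear, let $B=(S_kA_{2^j})^{-T}$. The coefficients over $m$ are, up to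
normalization, the Fourier coefficients of the periodization of $\overline{\mathcal Ff}\cdot
G(B\,\cdot)$ along the lattice $c_1^{-1}\mathbb Z\times c_2^{-1}\mathbb Z$ in the coordinates
$B\xi$. By Parseval their square sum is the diagonal term $(c_1c_2)^{-1}\int|\mathcal
Ff|^2|G(B\xi)|^2$ plus interactions of distinct translates. Schur's test bounds those by the
integral of $|\mathcal Ff|^2$ against $|G|\sum_{n\ne0}|G(\cdot+n/c)|$.

Splitting the exponent as $5/4=9/8+1/8$ balances the estimates. The part $1/8$ turns the lattice
spacing into a small factor $c^{1/8}$; the part $9/8>1$ makes the sum over translates converge and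
leaves an envelope whose sum over all scales and shears is bounded (`exists_tsum_translates_le`,
`exists_tsum_envelope_le`). This gives the upper bound for every $f$.

For the lower bound, every frequency in the cones is carried by some admissible pair $(j,k)$ into
the region where $G$ is large (`exists_scale_shear`). Hence the diagonal terms add up to at least a
multiple of $\|f\|^2$, and for small $c$ the off-diagonal terms are absorbed. -/

/-! ### Estimates for the polynomials $P_{N,l}$. -/

theorem one_le_pseudoSplinePoly (N l : ℕ) {x : ℝ} (hx : 0 ≤ x) : 1 ≤ pseudoSplinePoly N l x := by
  have h : ((N - 1 + 0).choose 0 : ℝ) * x ^ 0 ≤ pseudoSplinePoly N l x :=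
    Finset.single_le_sum (f := fun j => ((N - 1 + j).choose j : ℝ) * x ^ j)
      (fun j _ => by positivity) (by simp)
  simpa using h

theorem pseudoSplinePoly_mono (N l : ℕ) {x y : ℝ} (hx : 0 ≤ x) (hxy : x ≤ y) :
    pseudoSplinePoly N l x ≤ pseudoSplinePoly N l y := by
  unfold pseudoSplinePoly
  gcongr

/-- The polynomials `P_{N,l}` are partial sums of the series of `(1 - x) ^ (-N)`. -/
theorem one_sub_pow_mul_pseudoSplinePoly_le_one {N : ℕ} (hN : 0 < N) (l : ℕ) {x : ℝ} (hx : 0 ≤ x)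
    (hx1 : x ≤ 1) : (1 - x) ^ N * pseudoSplinePoly N l x ≤ 1 := by
  rcases hx1.eq_or_lt with rfl | hx1
  · simp [hN.ne']
  have hn : ‖x‖ < 1 := by rwa [Real.norm_of_nonneg hx]
  have hs := summable_choose_mul_geometric_of_norm_lt_one (R := ℝ) (N - 1) hn
  have ht := tsum_choose_mul_geometric_of_norm_lt_one (𝕜 := ℝ) (N - 1) hn
  rw [Nat.sub_add_cancel hN] at ht
  have hle : pseudoSplinePoly N l x ≤ 1 / (1 - x) ^ N := by
    rw [← ht]
    have h2 := hs.sum_le_tsum (Finset.range (l + 1)) (fun j _ => by positivity)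
    refine le_trans (le_of_eq (Finset.sum_congr rfl fun j _ => ?_)) h2
    rw [Nat.add_comm (N - 1) j, Nat.choose_symm_add]
  have hpos : 0 < (1 - x) ^ N := pow_pos (by linarith) N
  calc (1 - x) ^ N * pseudoSplinePoly N l x ≤ (1 - x) ^ N * (1 / (1 - x) ^ N) := by gcongr
    _ = 1 := by field_simp

/-- Passing from $k$ to $k+1$ multiplies the binomial by $2(2k+3)/(k+2)\le 4$. At $k=2$ there is
equality, $8\cdot10=5\cdot16$; the bound fails for smaller $k$. -/
theorem choose_two_mul_add_one_le {k : ℕ} (hk : 2 ≤ k) :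
    8 * (2 * k + 1).choose (k + 1) ≤ 5 * 4 ^ k := by
  induction k, hk using Nat.le_induction with
  | base => decide
  | succ k hk ih =>
    have h1 := Nat.add_one_mul_choose_eq (2 * k + 2) (k + 1)
    have h2 : (2 * k + 2).choose (k + 1) = 2 * (2 * k + 1).choose (k + 1) := by
      rw [Nat.choose_succ_succ' (2 * k + 1) k, Nat.choose_symm_half]
      ring
    have h3 : 2 * (k + 1) + 1 = 2 * k + 2 + 1 := by ring
    rw [h3, pow_succ]
    rw [h2] at h1
    have h4 : (k + 2) * (2 * k + 2 + 1).choose (k + 1 + 1)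
        ≤ (k + 2) * (4 * (2 * k + 1).choose (k + 1)) := by
      calc _ = (2 * k + 2 + 1).choose (k + 1 + 1) * (k + 1 + 1) := by ring
        _ = (2 * k + 3) * (2 * (2 * k + 1).choose (k + 1)) := by rw [← h1]
        _ ≤ _ := by nlinarith [Nat.zero_le ((2 * k + 1).choose (k + 1))]
    have h5 := Nat.le_of_mul_le_mul_left h4 (by omega)
    omega

/-- The hockey-stick identity sums the coefficients to one binomial, which is at most
$\binom{2N-1}{N}$ because $l\le N-1$. The gain of $5/8$ over $4^{N-1}$ is what lifts the decay
exponent of $\hat\phi$ above $1$. -/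
theorem pseudoSplinePoly_one_le {N l : ℕ} (hl : l < N) (hN : 3 ≤ N) :
    pseudoSplinePoly N l 1 ≤ 5 / 8 * 4 ^ (N - 1) := by
  obtain ⟨k, rfl⟩ : ∃ k, N = k + 1 := ⟨N - 1, by omega⟩
  have h : (∑ j ∈ Finset.range (l + 1), (k + j).choose j) ≤ (2 * k + 1).choose (k + 1) := by
    calc (∑ j ∈ Finset.range (l + 1), (k + j).choose j)
        = ∑ j ∈ Finset.range (l + 1), (j + k).choose k := by
          refine Finset.sum_congr rfl fun j _ => ?_
          rw [Nat.add_comm k j, Nat.choose_symm_add]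
      _ = (l + k + 1).choose (k + 1) := Nat.sum_range_add_choose l k
      _ ≤ _ := Nat.choose_le_choose _ (by omega)
  have h2 := choose_two_mul_add_one_le (k := k) (by omega)
  have h3 : 8 * (∑ j ∈ Finset.range (l + 1), (k + j).choose j) ≤ 5 * 4 ^ k := by omega
  have h4 : (8 : ℝ) * ∑ j ∈ Finset.range (l + 1), ((k + j).choose j : ℝ) ≤ 5 * 4 ^ k := by
    exact_mod_cast h3
  simp only [pseudoSplinePoly, Nat.add_sub_cancel, one_pow, mul_one]
  linarith

/-! ### Masks and refinable functions: decay, lower bounds and the zero of the high-pass filter. -/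

section Mask

variable {N l : ℕ} {a : ℤ →₀ ℝ}

theorem IsTypeIMask.norm_symbol_le_one (h : IsTypeIMask N l a) (hN : 0 < N) (ξ : ℝ) :
    ‖symbol a ξ‖ ≤ 1 := by
  rw [← sq_le_one_iff₀ (norm_nonneg _), h.norm_sq_eq, maskTypeII, pow_mul, Real.cos_sq']
  exact one_sub_pow_mul_pseudoSplinePoly_le_one hN l (sq_nonneg _) (Real.sin_sq_le_one _)

theorem IsTypeIMask.abs_cos_pow_le_norm_symbol (h : IsTypeIMask N l a) (ξ : ℝ) :
    |Real.cos (ξ / 2)| ^ N ≤ ‖symbol a ξ‖ := by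
  rw [← pow_le_pow_iff_left₀ (by positivity) (norm_nonneg _) two_ne_zero, h.norm_sq_eq, maskTypeII,
    ← pow_mul, mul_comm N 2, pow_mul, pow_mul, sq_abs]
  exact le_mul_of_one_le_right (by positivity) (one_le_pseudoSplinePoly N l (sq_nonneg _))

theorem IsTypeIMask.norm_symbol_le (h : IsTypeIMask N l a) (ξ : ℝ) :
    ‖symbol a ξ‖ ≤ √(pseudoSplinePoly N l 1) * |Real.cos (ξ / 2)| ^ N := by
  have hP : 0 ≤ pseudoSplinePoly N l 1 := zero_le_one.trans (one_le_pseudoSplinePoly N l zero_le_one)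
  rw [← pow_le_pow_iff_left₀ (norm_nonneg _) (by positivity) two_ne_zero, h.norm_sq_eq, maskTypeII,
    mul_pow, Real.sq_sqrt hP, ← pow_mul, mul_comm N 2, pow_mul, pow_mul, sq_abs, mul_comm]
  gcongr
  exact pseudoSplinePoly_mono N l (sq_nonneg _) (Real.sin_sq_le_one _)

theorem continuous_symbol (a : ℤ →₀ ℝ) : Continuous (symbol a) := by
  unfold symbol Finsupp.sum
  fun_prop

theorem tendsto_prod_refinableHat (h : IsTypeIMask N l a) (ξ : ℝ) :
    Tendsto (fun J => ∏ j ∈ Finset.range J, symbol a (ξ / 2 ^ (j + 1))) atTop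
      (𝓝 (refinableHat a ξ)) :=
  (multipliable_refinableHat a h.symbol_zero ξ).hasProd.tendsto_prod_nat

theorem IsTypeIMask.measurable_refinableHat (h : IsTypeIMask N l a) :
    Measurable (refinableHat a) := by
  refine measurable_of_tendsto_metrizable
    (f := fun J ξ => ∏ j ∈ Finset.range J, symbol a (ξ / 2 ^ (j + 1))) (fun J => ?_)
    (tendsto_pi_nhds.2 fun ξ => tendsto_prod_refinableHat h ξ)
  have := continuous_symbol a
  exact Continuous.measurable (by fun_prop)

/-- All factors have modulus at most $1$, so the moduli of the partial products decrease to that of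
the limit. -/
theorem IsTypeIMask.norm_refinableHat_le_prod (h : IsTypeIMask N l a) (hN : 0 < N) (ξ : ℝ) (J : ℕ) :
    ‖refinableHat a ξ‖ ≤ ∏ j ∈ Finset.range J, ‖symbol a (ξ / 2 ^ (j + 1))‖ := by
  refine le_of_tendsto (tendsto_prod_refinableHat h ξ).norm ?_
  filter_upwards [eventually_ge_atTop J] with n hn
  obtain ⟨t, rfl⟩ := Nat.exists_eq_add_of_le hn
  rw [norm_prod, Finset.prod_range_add]
  exact mul_le_of_le_one_right (Finset.prod_nonneg fun _ _ => norm_nonneg _)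
    (Finset.prod_le_one (fun _ _ => norm_nonneg _) fun i _ => h.norm_symbol_le_one hN _)

theorem IsTypeIMask.norm_refinableHat_le_one (h : IsTypeIMask N l a) (hN : 0 < N) (ξ : ℝ) :
    ‖refinableHat a ξ‖ ≤ 1 := by
  simpa using h.norm_refinableHat_le_prod hN ξ 0

/-- Viète's telescoping product: iterate $\sin 2u=2\sin u\cos u$. -/
theorem prod_cos_mul_sin (ξ : ℝ) (J : ℕ) :
    (∏ j ∈ Finset.range J, Real.cos (ξ / 2 ^ (j + 1) / 2)) * (2 ^ J * Real.sin (ξ / 2 ^ (J + 1)))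
      = Real.sin (ξ / 2) := by
  induction J with
  | zero => simp
  | succ J ih =>
    rw [← ih, Finset.prod_range_succ]
    have : Real.sin (ξ / 2 ^ (J + 1))
        = 2 * Real.sin (ξ / 2 ^ (J + 1 + 1)) * Real.cos (ξ / 2 ^ (J + 1) / 2) := by
      rw [pow_succ 2 (J + 1), ← div_div, ← Real.sin_two_mul]
      congr 1
      ring
    rw [this]
    ring

/-- In Viète's identity the right-hand side is at least $\frac2\pi|\xi/2|$ by Jordan's inequality,
while the sine on the left contributes at most $|\xi/2|$. -/
theorem two_div_pi_le_prod_cos {ξ : ℝ} (hξ : |ξ| ≤ Real.pi) (J : ℕ) :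
    2 / Real.pi ≤ ∏ j ∈ Finset.range J, |Real.cos (ξ / 2 ^ (j + 1) / 2)| := by
  rcases eq_or_ne ξ 0 with rfl | h0
  · simpa using (div_le_one Real.pi_pos).2 Real.two_le_pi
  have h1 := congrArg abs (prod_cos_mul_sin ξ J)
  rw [abs_mul, Finset.abs_prod, abs_mul, abs_of_pos (by positivity : (0 : ℝ) < 2 ^ J)] at h1
  have h2 : |Real.sin (ξ / 2 ^ (J + 1))| ≤ |ξ / 2 ^ (J + 1)| := Real.abs_sin_le_abs
  have h3 : 2 / Real.pi * |ξ / 2| ≤ |Real.sin (ξ / 2)| := by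
    apply Real.mul_abs_le_abs_sin
    rw [abs_div, abs_two]
    linarith
  have h4 : 2 ^ J * |ξ / 2 ^ (J + 1)| = |ξ / 2| := by
    rw [abs_div, abs_div, abs_of_pos (by positivity : (0 : ℝ) < 2 ^ (J + 1)), abs_two, pow_succ]
    field_simp
  have h5 : 2 / Real.pi * |ξ / 2|
      ≤ (∏ j ∈ Finset.range J, |Real.cos (ξ / 2 ^ (j + 1) / 2)|) * |ξ / 2| := by
    calc _ ≤ _ := h3
      _ = _ := h1.symm
      _ ≤ (∏ j ∈ Finset.range J, |Real.cos (ξ / 2 ^ (j + 1) / 2)|) * (2 ^ J * |ξ / 2 ^ (J + 1)|) := by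
        gcongr
      _ = _ := by rw [h4]
  exact le_of_mul_le_mul_right h5 (by positivity)

theorem IsTypeIMask.pow_le_norm_refinableHat (h : IsTypeIMask N l a) {ξ : ℝ}
    (hξ : |ξ| ≤ Real.pi) : (2 / Real.pi) ^ N ≤ ‖refinableHat a ξ‖ := by
  refine ge_of_tendsto' (tendsto_prod_refinableHat h ξ).norm fun J => ?_
  rw [norm_prod]
  calc (2 / Real.pi) ^ N ≤ (∏ j ∈ Finset.range J, |Real.cos (ξ / 2 ^ (j + 1) / 2)|) ^ N := by
        have := Real.pi_pos
        gcongr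
        exact two_div_pi_le_prod_cos hξ J
    _ = ∏ j ∈ Finset.range J, |Real.cos (ξ / 2 ^ (j + 1) / 2)| ^ N := (Finset.prod_pow _ _ _).symm
    _ ≤ _ := Finset.prod_le_prod (fun _ _ => by positivity)
        fun j _ => h.abs_cos_pow_le_norm_symbol _

/-- Each of the first $J$ factors costs at most $\sqrt{P_{N,l}(1)}$, and Viète's identity bounds the
product of cosines times the last sine by $2^{-J}$. The sine stays on the left until $J$ is chosen
so that it is bounded below. -/
theorem IsTypeIMask.norm_refinableHat_mul_le (h : IsTypeIMask N l a) (hN : 0 < N) (ξ : ℝ) (J : ℕ) :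
    ‖refinableHat a ξ‖ * |Real.sin (ξ / 2 ^ (J + 1))| ^ N
      ≤ (√(pseudoSplinePoly N l 1) / 2 ^ N) ^ J := by
  have h0 := h.norm_refinableHat_le_prod hN ξ J
  have h1 : ‖refinableHat a ξ‖ ≤ √(pseudoSplinePoly N l 1) ^ J
      * (∏ j ∈ Finset.range J, |Real.cos (ξ / 2 ^ (j + 1) / 2)|) ^ N := by
    refine h0.trans ?_
    calc _ ≤ ∏ j ∈ Finset.range J,
          (√(pseudoSplinePoly N l 1) * |Real.cos (ξ / 2 ^ (j + 1) / 2)| ^ N) :=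
        Finset.prod_le_prod (fun _ _ => norm_nonneg _) fun j _ => h.norm_symbol_le _
      _ = _ := by
        rw [Finset.prod_mul_distrib, Finset.prod_const, Finset.card_range, Finset.prod_pow]
  have h2 := congrArg abs (prod_cos_mul_sin ξ J)
  rw [abs_mul, Finset.abs_prod, abs_mul, abs_of_pos (by positivity : (0 : ℝ) < 2 ^ J)] at h2
  have h3 : (∏ j ∈ Finset.range J, |Real.cos (ξ / 2 ^ (j + 1) / 2)|)
      * |Real.sin (ξ / 2 ^ (J + 1))| ≤ 1 / 2 ^ J := by
    rw [le_div_iff₀ (by positivity)]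
    calc _ = _ := by ring
      _ = _ := h2
      _ ≤ 1 := Real.abs_sin_le_one _
  calc _ ≤ √(pseudoSplinePoly N l 1) ^ J
      * (∏ j ∈ Finset.range J, |Real.cos (ξ / 2 ^ (j + 1) / 2)|) ^ N
        * |Real.sin (ξ / 2 ^ (J + 1))| ^ N := by gcongr
    _ = √(pseudoSplinePoly N l 1) ^ J * ((∏ j ∈ Finset.range J, |Real.cos (ξ / 2 ^ (j + 1) / 2)|)
      * |Real.sin (ξ / 2 ^ (J + 1))|) ^ N := by rw [mul_pow]; ring
    _ ≤ √(pseudoSplinePoly N l 1) ^ J * (1 / 2 ^ J) ^ N := by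
        gcongr
    _ = _ := by
        rw [div_pow, div_pow, one_pow, ← pow_mul, ← pow_mul, mul_comm N J]
        ring

/-- Raised to the fourth power, this is $(5/32)^2=25/1024\le 1/32=2^{-5}$. -/
theorem sqrt_pseudoSplinePoly_div_le (hl : l < N) (hN : 3 ≤ N) :
    √(pseudoSplinePoly N l 1) / 2 ^ N ≤ (2 : ℝ) ^ (-(5 / 4) : ℝ) := by
  have hP : 0 ≤ pseudoSplinePoly N l 1 := zero_le_one.trans (one_le_pseudoSplinePoly N l zero_le_one)
  have h4 : (5 / 8 * 4 ^ (N - 1) : ℝ) = 5 / 32 * (2 ^ N) ^ 2 := by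
    obtain ⟨k, rfl⟩ : ∃ k, N = k + 1 := ⟨N - 1, by omega⟩
    rw [Nat.add_sub_cancel, ← pow_mul, mul_comm (k + 1) 2, pow_mul]
    norm_num [pow_succ]
    ring
  have hx : (0 : ℝ) ≤ (2 : ℝ) ^ (-(5 / 4) : ℝ) := by positivity
  rw [← pow_le_pow_iff_left₀ (by positivity) hx (n := 4) (by norm_num), div_pow,
    ← Real.rpow_mul_natCast (by norm_num)]
  have h5 : √(pseudoSplinePoly N l 1) ^ 4 = pseudoSplinePoly N l 1 ^ 2 := by
    rw [show 4 = 2 * 2 from rfl, pow_mul, Real.sq_sqrt hP]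
  have h6 : pseudoSplinePoly N l 1 ^ 2 ≤ (5 / 32 * (2 ^ N) ^ 2) ^ 2 := by
    rw [← h4]
    gcongr
    exact pseudoSplinePoly_one_le hl hN
  have h7 : (2 : ℝ) ^ (-(5 / 4) * ((4 : ℕ) : ℝ)) = 1 / 32 := by
    rw [show (-(5 / 4) * ((4 : ℕ) : ℝ) : ℝ) = ((-5 : ℤ) : ℝ) by norm_num, Real.rpow_intCast]
    norm_num
  rw [h5, h7, div_le_iff₀ (by positivity)]
  have : (0 : ℝ) < (2 ^ N) ^ 4 := by positivity
  nlinarith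

/-- For $2^J\le|\xi|<2^{J+1}$ the argument $|\xi|/2^{J+1}$ lies in $[1/2,1)$, so the sine is bounded
below, and the gain of $2^{-5/4}$ per dyadic step becomes the power $|\xi|^{-5/4}$. -/
theorem IsTypeIMask.exists_norm_refinableHat_le (h : IsTypeIMask N l a) (hl : l < N) (hN : 3 ≤ N) :
    ∃ C : ℝ, 1 ≤ C ∧ ∀ ξ, ‖refinableHat a ξ‖ ≤ C * (1 + |ξ|) ^ (-(5 / 4) : ℝ) := by
  have hs : 0 < Real.sin (1 / 2) := Real.sin_pos_of_pos_of_lt_pi (by norm_num)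
    (by linarith [Real.pi_gt_three])
  have hs1 : Real.sin (1 / 2) ^ N ≤ 1 := pow_le_one₀ hs.le (Real.sin_le_one _)
  have h4 : (1 : ℝ) ≤ 4 ^ (5 / 4 : ℝ) := Real.one_le_rpow (by norm_num) (by norm_num)
  -- The factor $4^{5/4}$ comes from $1+|\xi|\le 4\cdot2^J$, and the denominator from the lower
  -- bound for the sine.
  refine ⟨4 ^ (5 / 4 : ℝ) / Real.sin (1 / 2) ^ N, (one_le_div (by positivity)).2 (hs1.trans h4),
    fun ξ => ?_⟩
  rw [Real.rpow_neg (by positivity), ← div_eq_mul_inv, div_div, mul_comm, ← div_div,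
    le_div_iff₀ (by positivity), ← Real.div_rpow (by norm_num) (by positivity)]
  rcases lt_or_ge |ξ| 1 with h1 | h1
  · calc _ ≤ (1 : ℝ) * 1 := by
          gcongr
          exact h.norm_refinableHat_le_one (by omega) ξ
      _ ≤ _ := by
        rw [one_mul]
        refine Real.one_le_rpow ?_ (by norm_num)
        rw [le_div_iff₀ (by positivity)]
        linarith
  obtain ⟨J, hJ1, hJ2⟩ := exists_nat_pow_near h1 (one_lt_two : (1 : ℝ) < 2)
  have h2J : (0 : ℝ) < 2 ^ J := by positivity
  have hsin : Real.sin (1 / 2) ≤ |Real.sin (ξ / 2 ^ (J + 1))| := by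
    have e : |Real.sin (ξ / 2 ^ (J + 1))| = |Real.sin (|ξ| / 2 ^ (J + 1))| := by
      rcases abs_choice ξ with e | e <;> rw [e]
      rw [neg_div, Real.sin_neg, abs_neg]
    rw [e]
    refine le_trans ?_ (le_abs_self _)
    refine Real.sin_le_sin_of_le_of_le_pi_div_two (by linarith [Real.pi_gt_three]) ?_ ?_
    · have : |ξ| / 2 ^ (J + 1) ≤ 1 := by
        rw [div_le_one (by positivity)]
        exact hJ2.le
      linarith [Real.pi_gt_three]
    · rw [pow_succ, div_le_div_iff₀ (by norm_num) (by positivity)]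
      linarith
  calc ‖refinableHat a ξ‖ * Real.sin (1 / 2) ^ N
      ≤ ‖refinableHat a ξ‖ * |Real.sin (ξ / 2 ^ (J + 1))| ^ N := by gcongr
    _ ≤ (√(pseudoSplinePoly N l 1) / 2 ^ N) ^ J := h.norm_refinableHat_mul_le (by omega) ξ J
    _ ≤ ((2 : ℝ) ^ (-(5 / 4) : ℝ)) ^ J := by
        gcongr
        exact sqrt_pseudoSplinePoly_div_le hl hN
    _ = ((2 ^ J : ℝ)⁻¹) ^ (5 / 4 : ℝ) := by
        rw [Real.rpow_neg (by norm_num), Real.inv_rpow (by positivity), inv_pow,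
          Real.rpow_pow_comm (by norm_num)]
    _ ≤ _ := by
        refine Real.rpow_le_rpow (by positivity) ?_ (by norm_num)
        rw [inv_eq_one_div, div_le_div_iff₀ (by positivity) (by positivity)]
        rw [pow_succ] at hJ2
        linarith

theorem norm_highPass (a : ℤ →₀ ℝ) (ξ : ℝ) : ‖highPass a ξ‖ = ‖symbol a (ξ + Real.pi)‖ := by
  have : -Complex.I * (ξ : ℂ) = ((-ξ : ℝ) : ℂ) * Complex.I := by push_cast; ring
  rw [highPass, norm_mul, this, Complex.norm_exp_ofReal_mul_I, one_mul, RCLike.norm_conj]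

theorem measurable_highPass (a : ℤ →₀ ℝ) : Measurable (highPass a) := by
  have := continuous_symbol a
  have := Complex.continuous_conj
  unfold highPass
  exact Continuous.measurable (by fun_prop)

theorem cos_add_pi_div_two (ξ : ℝ) : Real.cos ((ξ + Real.pi) / 2) = -Real.sin (ξ / 2) := by
  rw [add_div, Real.cos_add_pi_div_two]

theorem IsTypeIMask.norm_highPass_le_one (h : IsTypeIMask N l a) (hN : 0 < N) (ξ : ℝ) :
    ‖highPass a ξ‖ ≤ 1 := by
  rw [norm_highPass]
  exact h.norm_symbol_le_one hN _

theorem IsTypeIMask.abs_sin_pow_le_norm_highPass (h : IsTypeIMask N l a) (ξ : ℝ) :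
    |Real.sin (ξ / 2)| ^ N ≤ ‖highPass a ξ‖ := by
  have := h.abs_cos_pow_le_norm_symbol (ξ + Real.pi)
  rwa [cos_add_pi_div_two, abs_neg, ← norm_highPass] at this

/-- The shift by $\pi$ turns the cosine power of the mask into a sine power, which gives $\hat b$ a
zero of order $N$ at the origin. -/
theorem IsTypeIMask.norm_highPass_le (h : IsTypeIMask N l a) (ξ : ℝ) :
    ‖highPass a ξ‖ ≤ √(pseudoSplinePoly N l 1) * |ξ| ^ N := by
  have := h.norm_symbol_le (ξ + Real.pi)
  rw [cos_add_pi_div_two, abs_neg, ← norm_highPass] at this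
  refine this.trans ?_
  have hs : |Real.sin (ξ / 2)| ≤ |ξ / 2| := Real.abs_sin_le_abs
  refine mul_le_mul_of_nonneg_left (pow_le_pow_left₀ (abs_nonneg _) (hs.trans ?_) N) (by positivity)
  rw [abs_div, abs_two]
  linarith [abs_nonneg ξ]

end Mask

/-! ### Weighted composition operators on $L^2$ of the plane. -/

section WeightedComposition

variable {e : Plane → Plane} {w : Plane → ℂ} {c : ENNReal} {C : NNReal}

/-- This makes $g\mapsto w\cdot(g\circ e)$ continuous on $L^2$. Both sides of the affine rule for
the Fourier transform involve such an operator, so that rule can be extended by density. -/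
theorem eLpNorm_weightedComp_le (he : Measurable e) (hmap : Measure.map e volume = c • volume)
    (hwC : ∀ x, ‖w x‖ ≤ C) {g : Plane → ℂ} (hg : AEStronglyMeasurable g volume) :
    eLpNorm (fun x => w x * g (e x)) 2 volume
      ≤ C * (c ^ (1 / 2 : ℝ) * eLpNorm g 2 volume) := by
  have h1 : eLpNorm (fun x => w x * g (e x)) 2 volume
      ≤ C * eLpNorm (fun x => g (e x)) 2 volume := by
    have := eLpNorm_le_nnreal_smul_eLpNorm_of_ae_le_mul (μ := (volume : Measure Plane))
      (f := fun x => w x * g (e x)) (g := fun x => g (e x)) (c := C)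
      (Eventually.of_forall fun x => by
        rw [nnnorm_mul]
        gcongr
        exact hwC x) 2
    simpa [ENNReal.smul_def] using this
  have hg' : AEStronglyMeasurable g (Measure.map e volume) := by
    rw [hmap]
    exact hg.smul_measure c
  have h2 : eLpNorm (fun x => g (e x)) 2 volume = c ^ (1 / 2 : ℝ) * eLpNorm g 2 volume := by
    change eLpNorm (g ∘ e) 2 volume = _
    rw [← eLpNorm_map_measure hg' he.aemeasurable, hmap,
      eLpNorm_smul_measure_of_ne_top (by norm_num)]
    simp
  rw [← h2]
  exact h1

theorem memLp_weightedComp (he : Measurable e) (hc : c ≠ ⊤)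
    (hmap : Measure.map e volume = c • volume) (hw : Measurable w) (hwC : ∀ x, ‖w x‖ ≤ C)
    {g : Plane → ℂ} (hg : MemLp g 2 volume) :
    MemLp (fun x => w x * g (e x)) 2 volume := by
  refine ⟨?_, (eLpNorm_weightedComp_le he hmap hwC hg.1).trans_lt ?_⟩
  · refine hw.aestronglyMeasurable.mul ?_
    refine AEStronglyMeasurable.comp_measurable ?_ he
    rw [hmap]
    exact hg.1.smul_measure c
  · have := hg.2
    refine ENNReal.mul_lt_top (by simp) (ENNReal.mul_lt_top ?_ this)
    exact ENNReal.rpow_lt_top_of_nonneg (by norm_num) hc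

theorem continuous_weightedComp (he : Measurable e) (hc : c ≠ ⊤)
    (hmap : Measure.map e volume = c • volume) (hw : Measurable w) (hwC : ∀ x, ‖w x‖ ≤ C) :
    Continuous fun g : L2Plane => (memLp_weightedComp he hc hmap hw hwC (Lp.memLp g)).toLp := by
  refine LipschitzWith.continuous (K := C * (c ^ (1 / 2 : ℝ)).toNNReal) fun g h => ?_
  rw [Lp.edist_toLp_toLp, Lp.edist_def, ENNReal.coe_mul, ENNReal.coe_toNNReal
    (ENNReal.rpow_lt_top_of_nonneg (by norm_num) hc).ne, mul_assoc]
  refine le_trans (le_of_eq ?_) (eLpNorm_weightedComp_le he hmap hwC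
    ((Lp.aestronglyMeasurable g).sub (Lp.aestronglyMeasurable h)))
  congr 1
  ext x
  simp [mul_sub]

end WeightedComposition

/-! ### The $L^2$ Fourier transform under affine changes of variables. -/

section Affine

variable {A B : Plane ≃L[ℝ] Plane} {d : ℝ}

theorem map_sub_eq_smul (hmap : Measure.map A volume = ENNReal.ofReal d • volume) (v : Plane) :
    Measure.map (fun x => A x - v) volume = ENNReal.ofReal d • (volume : Measure Plane) := by
  have h := Measure.map_map (μ := (volume : Measure Plane)) (measurable_sub_const v)
    A.continuous.measurable
  change Measure.map ((fun x => x - v) ∘ A) volume = _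
  rw [← h, hmap, Measure.map_smul, (measurePreserving_sub_right volume v).map_eq]

-- The pointwise rule for integrals. The hypothesis `hAB` says that $B$ is the inverse transpose of
-- $A$, and $d$ is the Jacobian factor $|\det A|^{-1}$.
open RealInnerProductSpace in
theorem fourier_comp_affine_schwartz (hd : 0 ≤ d)
    (hmap : Measure.map A volume = ENNReal.ofReal d • volume)
    (hAB : ∀ x ξ, ⟪A x, B ξ⟫ = ⟪x, ξ⟫) (v : Plane) (s : ℂ) (f : Plane → ℂ) (ξ : Plane) :
    𝓕 (fun x => s * f (A x - v)) ξ
      = s * d * Complex.exp (-2 * Real.pi * Complex.I * ⟪v, B ξ⟫) * 𝓕 f (B ξ) := by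
  have hemb : MeasurableEmbedding (fun x => A x - v) :=
    ((Homeomorph.subRight v).measurableEmbedding).comp A.toHomeomorph.measurableEmbedding
  have h1 : ∫ y, Real.fourierChar (-⟪y + v, B ξ⟫) • (s * f y) ∂(ENNReal.ofReal d • volume)
      = ∫ x, Real.fourierChar (-⟪x, ξ⟫) • (s * f (A x - v)) := by
    rw [← map_sub_eq_smul hmap v, hemb.integral_map]
    simp [hAB]
  rw [Real.fourier_eq, ← h1, integral_smul_measure, ENNReal.toReal_ofReal hd, Real.fourier_eq,
    ← integral_const_mul, ← integral_smul]
  congr 1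
  ext y
  simp only [inner_add_left, neg_add, AddChar.map_add_eq_mul, Circle.smul_def, Circle.coe_mul,
    Real.fourierChar_apply, smul_eq_mul, Complex.real_smul]
  have : (-2 * Real.pi * Complex.I * ⟪v, B ξ⟫ : ℂ)
      = ((2 * Real.pi * -⟪v, B ξ⟫ : ℝ) : ℂ) * Complex.I := by push_cast; ring
  rw [this]
  ring

open RealInnerProductSpace in
/-- The `L²` Fourier transform of an affine change of variables. -/
theorem fourier_comp_affine (hd : 0 ≤ d)
    (hmap : Measure.map A volume = ENNReal.ofReal d • volume)
    {d' : ENNReal} (hd' : d' ≠ ⊤) (hmapB : Measure.map B volume = d' • volume)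
    (hAB : ∀ x ξ, ⟪A x, B ξ⟫ = ⟪x, ξ⟫) (v : Plane) (s : ℂ) (ψ : L2Plane)
    (hψ : MemLp (fun x => s * ψ (A x - v)) 2 volume) :
    (𝓕 (hψ.toLp _) : L2Plane) =ᵐ[volume] fun ξ =>
      s * d * Complex.exp (-2 * Real.pi * Complex.I * ⟪v, B ξ⟫) * (𝓕 ψ : L2Plane) (B ξ) := by
  have heA : Measurable fun x => A x - v := A.continuous.measurable.sub_const v
  have hmapA := map_sub_eq_smul hmap v
  have hsC : ∀ _ : Plane, ‖s‖ ≤ ‖s‖₊ := fun _ => le_rfl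
  set w : Plane → ℂ := fun ξ => s * d * Complex.exp (-2 * Real.pi * Complex.I * ⟪v, B ξ⟫) with hwdef
  have hw : Measurable w := by
    have : Continuous w := by fun_prop
    exact this.measurable
  have hwC : ∀ ξ, ‖w ξ‖ ≤ ‖s * d‖₊ := by
    intro ξ
    have : (-2 * Real.pi * Complex.I * ⟪v, B ξ⟫ : ℂ)
      = ((2 * Real.pi * -⟪v, B ξ⟫ : ℝ) : ℂ) * Complex.I := by push_cast; ring
    rw [hwdef]
    dsimp only
    rw [norm_mul, this, Complex.norm_exp_ofReal_mul_I, mul_one]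
    rfl
  have hBm : Measurable B := B.continuous.measurable
  have key : (𝓕 ((memLp_weightedComp heA ENNReal.ofReal_ne_top hmapA measurable_const hsC
      (Lp.memLp ψ)).toLp _) : L2Plane)
      = (memLp_weightedComp hBm hd' hmapB hw hwC (Lp.memLp (𝓕 ψ : L2Plane))).toLp _ := by
    -- Both sides depend continuously on $\psi\in L^2$, so it is enough to compare them on Schwartz
    -- functions, where the integral formula applies.
    refine DenseRange.induction_on (p := fun ψ : L2Plane =>
      (𝓕 ((memLp_weightedComp heA ENNReal.ofReal_ne_top hmapA measurable_const hsC
      (Lp.memLp ψ)).toLp _) : L2Plane)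
      = (memLp_weightedComp hBm hd' hmapB hw hwC (Lp.memLp (𝓕 ψ : L2Plane))).toLp _)
      (SchwartzMap.denseRange_toLpCLM (E := Plane) (F := ℂ) (p := 2) (μ := volume)
        ENNReal.ofNat_ne_top) ψ ?_ ?_
    · refine isClosed_eq ?_ ?_
      · exact (Lp.fourierTransformₗᵢ Plane ℂ).continuous.comp
          (continuous_weightedComp heA ENNReal.ofReal_ne_top hmapA measurable_const hsC)
      · exact (continuous_weightedComp hBm hd' hmapB hw hwC).comp
          (Lp.fourierTransformₗᵢ Plane ℂ).continuous
    · intro f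
      have hqA : Measure.QuasiMeasurePreserving (fun x => A x - v) volume volume :=
        ⟨heA, by rw [hmapA]; exact Measure.smul_absolutelyContinuous⟩
      have hqB : Measure.QuasiMeasurePreserving B volume volume :=
        ⟨hBm, by rw [hmapB]; exact Measure.smul_absolutelyContinuous⟩
      set f' : SchwartzMap Plane ℂ := s • SchwartzMap.compCLMOfContinuousLinearEquiv ℂ A
        (SchwartzMap.compSubConstCLM ℂ v f) with hf'
      have h1 : (memLp_weightedComp heA ENNReal.ofReal_ne_top hmapA measurable_const hsC
          (Lp.memLp (SchwartzMap.toLpCLM ℝ ℂ 2 volume f))).toLp _ = f'.toLp 2 := by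
        apply Lp.ext
        filter_upwards [MemLp.coeFn_toLp (memLp_weightedComp heA ENNReal.ofReal_ne_top hmapA
          measurable_const hsC (Lp.memLp (SchwartzMap.toLpCLM ℝ ℂ 2 volume f))),
          f'.coeFn_toLp 2 volume, hqA.ae (f.coeFn_toLp 2 volume)] with x h1 h2 h3
        rw [h1, h2, SchwartzMap.toLpCLM_apply, h3]
        simp [hf']
      rw [h1, SchwartzMap.toLp_fourier_eq]
      apply Lp.ext
      filter_upwards [MemLp.coeFn_toLp (memLp_weightedComp hBm hd' hmapB hw hwC
        (Lp.memLp (𝓕 (SchwartzMap.toLpCLM ℝ ℂ 2 volume f) : L2Plane))),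
        (𝓕 f').coeFn_toLp 2 volume, hqB.ae ((𝓕 f).coeFn_toLp 2 volume)] with ξ h1 h2 h3
      rw [h1, h2, SchwartzMap.toLpCLM_apply, SchwartzMap.toLp_fourier_eq, h3,
        SchwartzMap.fourier_coe, SchwartzMap.fourier_coe]
      have h4 : (f' : Plane → ℂ) = fun x => s * f (A x - v) := by
        ext x
        simp [hf']
      rw [h4, fourier_comp_affine_schwartz hd hmap hAB]
  have h2 := MemLp.coeFn_toLp (memLp_weightedComp hBm hd' hmapB hw hwC
    (Lp.memLp (𝓕 ψ : L2Plane)))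
  rw [← key] at h2
  exact h2

end Affine

/-! ### Periodization over the integer lattice and Parseval's identity. -/

section Periodization

variable {ι : Type*}

/-- An integer vector as a real vector. -/
def intVec (n : ι → ℤ) : ι → ℝ := fun i => n i

theorem intVec_add (m n : ι → ℤ) : intVec (m + n) = intVec m + intVec n := by
  ext i
  simp [intVec]

variable (ι) in
/-- The half-open unit cube. -/
def unitCube : Set (ι → ℝ) := {x | ∀ i, x i ∈ Set.Ioc ((0 : ι → ℝ) i) ((0 : ι → ℝ) i + 1)}

theorem measurableSet_unitCube [Fintype ι] : MeasurableSet (unitCube ι) :=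
  MeasurableSet.univ_pi' fun _ => measurableSet_Ioc

/-- The index of the translate of the unit cube which contains a given point. -/
def cubeIndex (x : ι → ℝ) : ι → ℤ := fun i => ⌈x i⌉ - 1

theorem measurable_cubeIndex : Measurable (cubeIndex (ι := ι)) :=
  measurable_pi_lambda _ fun i => ((Int.measurable_ceil.comp (measurable_pi_apply i)).sub_const 1)

theorem add_intVec_mem_cubeIndex_preimage {y : ι → ℝ} {n : ι → ℤ} :
    y + intVec n ∈ cubeIndex ⁻¹' {n} ↔ y ∈ unitCube ι := by
  simp only [Set.mem_preimage, Set.mem_singleton_iff, funext_iff, cubeIndex, unitCube, intVec,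
    Pi.add_apply, Int.ceil_add_intCast, Set.mem_ofPred_eq, Set.mem_Ioc, Pi.zero_apply]
  refine forall_congr' fun i => ?_
  rw [show ⌈y i⌉ + n i - 1 = n i ↔ ⌈y i⌉ = 1 by omega, Int.ceil_eq_iff]
  norm_num

theorem iUnion_cubeIndex_preimage : (⋃ n : ι → ℤ, cubeIndex ⁻¹' {n}) = Set.univ := by
  ext x
  simp

theorem disjoint_cubeIndex_preimage :
    Pairwise (Function.onFun Disjoint fun n : ι → ℤ => (cubeIndex ⁻¹' {n} : Set (ι → ℝ))) := by
  intro m n hmn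
  exact Disjoint.preimage _ (by simpa using hmn)

variable [Fintype ι]

theorem lintegral_eq_tsum_unitCube (H : (ι → ℝ) → ENNReal) :
    ∫⁻ y, H y = ∑' n : ι → ℤ, ∫⁻ y in unitCube ι, H (y + intVec n) := by
  have hm : ∀ n : ι → ℤ, MeasurableSet (cubeIndex ⁻¹' {n} : Set (ι → ℝ)) :=
    fun n => measurable_cubeIndex (measurableSet_singleton n)
  rw [← setLIntegral_univ, ← iUnion_cubeIndex_preimage,
    lintegral_iUnion hm disjoint_cubeIndex_preimage]
  congr 1
  ext n
  rw [← lintegral_indicator (hm n), ← lintegral_indicator measurableSet_unitCube,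
    ← lintegral_add_right_eq_self _ (intVec n)]
  congr 1
  ext y
  by_cases hy : y ∈ unitCube ι
  · rw [Set.indicator_of_mem (add_intVec_mem_cubeIndex_preimage.2 hy), Set.indicator_of_mem hy]
  · rw [Set.indicator_of_notMem (mt add_intVec_mem_cubeIndex_preimage.1 hy),
      Set.indicator_of_notMem hy]

theorem lintegral_unitCube_tsum {H : (ι → ℝ) → ENNReal} (hH : Measurable H) :
    ∫⁻ y in unitCube ι, ∑' n : ι → ℤ, H (y + intVec n) = ∫⁻ y, H y := by
  have hm : ∀ n : ι → ℤ, Measurable fun y => H (y + intVec n) :=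
    fun n => hH.comp (measurable_add_const _)
  rw [lintegral_tsum fun n => (hm n).aemeasurable, lintegral_eq_tsum_unitCube]

theorem integral_unitCube_tsum {H : (ι → ℝ) → ℂ} (hH : Integrable H) :
    ∫ y in unitCube ι, ∑' n : ι → ℤ, H (y + intVec n) = ∫ y, H y := by
  have hm : ∀ n : ι → ℤ, MeasurableSet (cubeIndex ⁻¹' {n} : Set (ι → ℝ)) :=
    fun n => measurable_cubeIndex (measurableSet_singleton n)
  have hfin := hH.2.ne
  rw [lintegral_eq_tsum_unitCube] at hfin
  rw [integral_tsum (fun n => ((hH.comp_add_right (intVec n)).1.mono_measure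
    Measure.restrict_le_self)) hfin]
  have h := hasSum_integral_iUnion hm disjoint_cubeIndex_preimage
    (hH.integrableOn (s := ⋃ n : ι → ℤ, cubeIndex ⁻¹' {n}))
  rw [iUnion_cubeIndex_preimage, setIntegral_univ] at h
  rw [← h.tsum_eq]
  congr 1
  ext n
  rw [← integral_indicator (hm n), ← integral_indicator measurableSet_unitCube,
    ← integral_add_right_eq_self ((cubeIndex ⁻¹' {n}).indicator H) (intVec n)]
  congr 1
  ext y
  by_cases hy : y ∈ unitCube ι
  · rw [Set.indicator_of_mem (add_intVec_mem_cubeIndex_preimage.2 hy), Set.indicator_of_mem hy]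
  · rw [Set.indicator_of_notMem (mt add_intVec_mem_cubeIndex_preimage.1 hy),
      Set.indicator_of_notMem hy]

theorem ae_unitCube_tsum_lt_top {H : (ι → ℝ) → ENNReal} (hH : Measurable H)
    (hfin : ∫⁻ y, H y ≠ ⊤) :
    ∀ᵐ y ∂(volume.restrict (unitCube ι)), ∑' n : ι → ℤ, H (y + intVec n) < ⊤ := by
  refine ae_lt_top ?_ ?_
  · exact Measurable.tsum fun n => hH.comp (measurable_add_const _)
  · rwa [lintegral_unitCube_tsum hH]

/-- The character `y ↦ exp (2πi m·y)` of `ℝ^ι`. -/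
def intChar (m : ι → ℤ) (y : ι → ℝ) : ℂ :=
  UnitAddTorus.mFourier m fun i => (y i : UnitAddCircle)

theorem intChar_eq (m : ι → ℤ) (y : ι → ℝ) :
    intChar m y = Complex.exp (2 * Real.pi * Complex.I * ∑ i, m i * y i) := by
  simp only [intChar, UnitAddTorus.mFourier, ContinuousMap.coe_mk, fourier_coe_apply,
    ← Complex.exp_sum]
  rw [Complex.ofReal_sum, Finset.mul_sum]
  congr 1
  refine Finset.sum_congr rfl fun i _ => ?_
  push_cast
  ring

theorem intChar_add_intVec (m n : ι → ℤ) (y : ι → ℝ) :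
    intChar m (y + intVec n) = intChar m y := by
  unfold intChar
  congr 1
  ext i
  simp [intVec]

theorem norm_intChar (m : ι → ℤ) (y : ι → ℝ) : ‖intChar m y‖ = 1 := by
  rw [intChar_eq]
  have : (2 * Real.pi * Complex.I * ∑ i, m i * y i : ℂ)
      = ((2 * Real.pi * ∑ i, m i * y i : ℝ) : ℂ) * Complex.I := by push_cast; ring
  rw [this, Complex.norm_exp_ofReal_mul_I]

theorem continuous_intChar (m : ι → ℤ) : Continuous (intChar m) := by
  have : intChar m = fun y : ι → ℝ => Complex.exp (2 * Real.pi * Complex.I * ∑ i, m i * y i) :=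
    funext (intChar_eq m)
  rw [this]
  fun_prop

/-- The circle of unit length with its Haar probability measure. -/
local instance unitAddCircleMeasureSpace : MeasureSpace UnitAddCircle := ⟨AddCircle.haarAddCircle⟩

/-- Parseval for Fourier series on the torus, transported to the half-open cube. -/
theorem tsum_enorm_sq_setIntegral_intChar {P : (ι → ℝ) → ℂ}
    (hP : MemLp P 2 (volume.restrict (unitCube ι))) :
    ∑' m : ι → ℤ, ‖∫ y in unitCube ι, intChar (-m) y * P y‖ₑ ^ 2
      = ∫⁻ y in unitCube ι, ‖P y‖ₑ ^ 2 := by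
  -- The section of $\mathbb R^\iota\to\mathbb T^\iota$ with values in the cube; it carries Haar
  -- measure to Lebesgue measure there.
  set ρ : UnitAddTorus ι → ι → ℝ := fun t => (UnitAddTorus.measurableEquivPiIoc 0 t).1 with hρ
  have hρmp : MeasurePreserving ρ volume (volume.restrict (unitCube ι)) :=
    (measurePreserving_subtype_coe measurableSet_unitCube).comp
      (UnitAddTorus.measurePreserving_equivPiIoc (0 : ι → ℝ))
  have hρc : ∀ y ∈ unitCube ι, ρ (fun i => (y i : UnitAddCircle)) = y := by
    intro y hy
    ext i
    simp only [hρ, UnitAddTorus.coe_measurableEquivPiIoc_apply]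
    rw [AddCircle.equivIoc_coe_eq (hy i)]
  have hg : MemLp (P ∘ ρ) 2 volume := hP.comp_measurePreserving hρmp
  have hs := UnitAddTorus.hasSum_sq_mFourierCoeff hg.toLp
  have hcoef : ∀ m, UnitAddTorus.mFourierCoeff hg.toLp m
      = ∫ y in unitCube ι, intChar (-m) y * P y := by
    intro m
    have h1 : UnitAddTorus.mFourierCoeff hg.toLp m = UnitAddTorus.mFourierCoeff (P ∘ ρ) m := by
      refine integral_congr_ae ?_
      filter_upwards [hg.coeFn_toLp] with t ht
      rw [ht]
    rw [h1, UnitAddTorus.mFourierCoeff_eq_integral _ m 0]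
    refine setIntegral_congr_fun measurableSet_unitCube fun y hy => ?_
    simp only [Function.comp_apply, hρc y hy, smul_eq_mul]
    rfl
  have h2 : ∑' m : ι → ℤ, ‖∫ y in unitCube ι, intChar (-m) y * P y‖ₑ ^ 2
      = ENNReal.ofReal (∫ t, ‖hg.toLp _ t‖ ^ 2) := by
    rw [← hs.tsum_eq, ENNReal.ofReal_tsum_of_nonneg (fun _ => by positivity) hs.summable]
    refine tsum_congr fun m => ?_
    rw [hcoef, ENNReal.ofReal_pow (norm_nonneg _), ofReal_norm]
  rw [h2, ofReal_integral_eq_lintegral_ofReal]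
  · have h3 : ∫⁻ t, ENNReal.ofReal (‖hg.toLp _ t‖ ^ 2) = ∫⁻ t, ‖P (ρ t)‖ₑ ^ 2 := by
      refine lintegral_congr_ae ?_
      filter_upwards [hg.coeFn_toLp] with t ht
      rw [ht, ENNReal.ofReal_pow (norm_nonneg _), ofReal_norm]
      rfl
    rw [h3, ← lintegral_map' (f := fun y => ‖P y‖ₑ ^ 2) (g := ρ) ?_ hρmp.measurable.aemeasurable,
      hρmp.map_eq]
    rw [hρmp.map_eq]
    exact hP.1.enorm.pow_const 2
  · exact (Lp.memLp _).integrable_norm_pow (by norm_num)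
  · exact Eventually.of_forall fun _ => by positivity

/-- Parseval's identity for periodizations. -/
theorem tsum_enorm_sq_integral_intChar {H : (ι → ℝ) → ℂ} (hH : Measurable H)
    (hfin : ∫⁻ y in unitCube ι, (∑' n : ι → ℤ, ‖H (y + intVec n)‖ₑ) ^ 2 ≠ ⊤) :
    Integrable H ∧ ∑' m : ι → ℤ, ‖∫ y, intChar (-m) y * H y‖ₑ ^ 2
      = ∫⁻ y in unitCube ι, ‖∑' n : ι → ℤ, H (y + intVec n)‖ₑ ^ 2 := by
  have hvol : volume (unitCube ι) ≠ ⊤ := by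
    have : unitCube ι = Set.univ.pi fun _ => Set.Ioc (0 : ℝ) 1 := by
      ext; simp [unitCube]
    rw [this, Real.volume_pi_Ioc]
    simp
  have hint : Integrable H := by
    refine ⟨hH.aestronglyMeasurable, ?_⟩
    rw [HasFiniteIntegral, ← lintegral_unitCube_tsum hH.enorm]
    -- Square integrability gives integrability on the cube, which has finite measure, through $t\le
    -- 1+t^2$.
    calc _ ≤ ∫⁻ y in unitCube ι, (1 + (∑' n : ι → ℤ, ‖H (y + intVec n)‖ₑ) ^ 2) := by
          refine lintegral_mono fun y => ?_
          rcases le_total (∑' n : ι → ℤ, ‖H (y + intVec n)‖ₑ) 1 with h | h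
          · exact h.trans le_self_add
          · exact (le_self_pow₀ h two_ne_zero).trans le_add_self
      _ = volume (unitCube ι) + _ := by
          rw [lintegral_add_left measurable_const, setLIntegral_const, one_mul]
      _ < ⊤ := ENNReal.add_lt_top.2 ⟨hvol.lt_top, hfin.lt_top⟩
  refine ⟨hint, ?_⟩
  have hae := ae_unitCube_tsum_lt_top hH.enorm (by simpa [HasFiniteIntegral] using hint.2.ne)
  have hmeas : AEStronglyMeasurable (fun y => ∑' n : ι → ℤ, H (y + intVec n))
      (volume.restrict (unitCube ι)) := by
    refine aestronglyMeasurable_of_tendsto_ae (u := (atTop : Filter (Finset (ι → ℤ))))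
      (f := fun s y => ∑ n ∈ s, H (y + intVec n)) (fun s => ?_) ?_
    · exact (Finset.measurable_fun_sum s fun n _ =>
        hH.comp (measurable_add_const _)).aestronglyMeasurable
    · filter_upwards [hae] with y hy
      have hs : Summable fun n : ι → ℤ => H (y + intVec n) :=
        Summable.of_norm (by
          have := ENNReal.summable_toReal hy.ne
          simpa using this)
      exact hs.hasSum
  have hP : MemLp (fun y => ∑' n : ι → ℤ, H (y + intVec n)) 2 (volume.restrict (unitCube ι)) := by
    refine ⟨hmeas, ?_⟩
    rw [eLpNorm_lt_top_iff_lintegral_rpow_enorm_lt_top two_ne_zero ENNReal.ofNat_ne_top]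
    refine lt_of_le_of_lt (lintegral_mono fun y => ?_) hfin.lt_top
    simp only [ENNReal.toReal_ofNat, ENNReal.rpow_ofNat]
    gcongr
    exact enorm_tsum_le_tsum_enorm
  rw [← tsum_enorm_sq_setIntegral_intChar hP]
  refine tsum_congr fun m => ?_
  have hint' : Integrable fun y => intChar (-m) y * H y :=
    hint.bdd_mul (c := 1) (continuous_intChar _).aestronglyMeasurable
      (Eventually.of_forall fun y => (norm_intChar _ y).le)
  -- The characters are invariant under integer translations, so the integral over the whole space
  -- is a Fourier coefficient of the periodization.
  rw [← integral_unitCube_tsum hint']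
  simp_rw [intChar_add_intVec, tsum_mul_left]

end Periodization

/-! ### Schur's test and the separation of the diagonal. -/

section Schur

theorem ennreal_mul_le_sq_add_sq (a b : ENNReal) : a * b ≤ a ^ 2 + b ^ 2 := by
  rcases le_total a b with h | h
  · calc a * b ≤ b * b := by gcongr
      _ = b ^ 2 := (sq b).symm
      _ ≤ _ := le_add_self
  · calc a * b ≤ a * a := by gcongr
      _ = a ^ 2 := (sq a).symm
      _ ≤ _ := le_self_add

/-- Schur's test for a symmetric kernel `k`. -/
theorem tsum_tsum_mul_le_schur {κ : Type*} (k : κ → κ → ENNReal) (hk : ∀ m n, k m n = k n m)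
    (u w : κ → ENNReal) :
    ∑' m, u m * w m * ∑' n, k m n * (u n * w n)
      ≤ 2 * ∑' m, u m ^ 2 * (w m * ∑' n, k m n * w n) := by
  have h1 : ∑' m, u m * w m * ∑' n, k m n * (u n * w n)
      ≤ ∑' m, ∑' n, (u m ^ 2 * (w m * (k m n * w n)) + u n ^ 2 * (w n * (k n m * w m))) := by
    refine ENNReal.tsum_le_tsum fun m => ?_
    rw [← ENNReal.tsum_mul_left]
    refine ENNReal.tsum_le_tsum fun n => ?_
    calc u m * w m * (k m n * (u n * w n)) = (u m * u n) * (w m * (k m n * w n)) := by ring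
      _ ≤ (u m ^ 2 + u n ^ 2) * (w m * (k m n * w n)) := by
        gcongr
        exact ennreal_mul_le_sq_add_sq _ _
      _ = _ := by rw [hk n m]; ring
  refine h1.trans (le_of_eq ?_)
  simp_rw [ENNReal.tsum_add]
  rw [ENNReal.tsum_comm (f := fun m n => u n ^ 2 * (w n * (k n m * w m))), two_mul]
  simp_rw [ENNReal.tsum_mul_left]

/-- With $S=\sum x_n$, write $|x_n|^2=\mathrm{Re}\,(x_n\bar
S)+\mathrm{Re}\,(x_n\overline{(x_n-S)})$. The first terms add up to $|S|^2$, and $S-x_n$ is the sum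
of the other entries. The off-diagonal part is thus subtracted without subtraction in `ENNReal`. -/
theorem tsum_enorm_sq_le {κ : Type*} [DecidableEq κ] {x : κ → ℂ} (hx : ∑' n, ‖x n‖ₑ ≠ ⊤) :
    ∑' n, ‖x n‖ₑ ^ 2
      ≤ ‖∑' n, x n‖ₑ ^ 2 + ∑' m, ‖x m‖ₑ * ∑' n, (if n = m then 0 else 1) * ‖x n‖ₑ := by
  have hsn : Summable fun n => ‖x n‖ := by simpa using ENNReal.summable_toReal hx
  have hs : Summable x := hsn.of_norm
  set S := ∑' n, x n with hS
  have h0 : ∀ n, ‖x n‖ ≤ ∑' n, ‖x n‖ := fun n => hsn.le_tsum n fun _ _ => norm_nonneg _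
  have hd : ∀ n, ‖S - x n‖ₑ ≤ ∑' m, (if m = n then 0 else 1) * ‖x m‖ₑ := by
    intro n
    have h1 : S - x n = ∑' m, if m = n then 0 else x m := by
      rw [hS, hs.tsum_eq_add_tsum_ite n, add_sub_cancel_left]
    rw [h1]
    refine enorm_tsum_le_tsum_enorm.trans (ENNReal.tsum_le_tsum fun m => ?_)
    split_ifs <;> simp
  have hpt : ∀ n, ‖x n‖ ^ 2 ≤ (x n * (starRingEnd ℂ) S).re + ‖x n‖ * ‖S - x n‖ := by
    intro n
    have h1 : (x n * (starRingEnd ℂ) (x n)).re = ‖x n‖ ^ 2 := by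
      rw [Complex.mul_conj, Complex.ofReal_re, Complex.normSq_eq_norm_sq]
    have h2 : (x n * (starRingEnd ℂ) (x n - S)).re ≤ ‖x n‖ * ‖S - x n‖ := by
      refine (Complex.re_le_norm _).trans ?_
      rw [norm_mul, RCLike.norm_conj, norm_sub_rev]
    rw [← h1]
    have h3 : (x n * (starRingEnd ℂ) (x n)).re
        = (x n * (starRingEnd ℂ) S).re + (x n * (starRingEnd ℂ) (x n - S)).re := by
      rw [← Complex.add_re, map_sub]
      ring_nf
    linarith
  have hsq : Summable fun n => ‖x n‖ ^ 2 := by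
    refine Summable.of_nonneg_of_le (fun _ => by positivity) (fun n => ?_)
      (hsn.mul_left (∑' n, ‖x n‖))
    rw [sq]
    gcongr
    exact h0 n
  have hprod : Summable fun n => ‖x n‖ * ‖S - x n‖ := by
    refine Summable.of_nonneg_of_le (fun _ => by positivity) (fun n => ?_)
      (hsn.mul_right (‖S‖ + ∑' n, ‖x n‖))
    gcongr
    exact (norm_sub_le _ _).trans (by gcongr; exact h0 n)
  have hre : HasSum (fun n => (x n * (starRingEnd ℂ) S).re) (‖S‖ ^ 2) := by
    have h1 := Complex.hasSum_re (hs.hasSum.mul_right ((starRingEnd ℂ) S))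
    rwa [← hS, Complex.mul_conj, Complex.ofReal_re, Complex.normSq_eq_norm_sq] at h1
  have hmain : ∑' n, ‖x n‖ ^ 2 ≤ ‖S‖ ^ 2 + ∑' n, ‖x n‖ * ‖S - x n‖ := by
    rw [← hre.tsum_eq, ← hre.summable.tsum_add hprod]
    exact hsq.tsum_le_tsum hpt (hre.summable.add hprod)
  have h3 := ENNReal.ofReal_le_ofReal hmain
  rw [ENNReal.ofReal_add (by positivity) (tsum_nonneg fun _ => by positivity),
    ENNReal.ofReal_tsum_of_nonneg (fun _ => by positivity) hsq,
    ENNReal.ofReal_tsum_of_nonneg (fun _ => by positivity) hprod] at h3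
  simp only [ENNReal.ofReal_pow (norm_nonneg _), ENNReal.ofReal_mul (norm_nonneg _),
    ofReal_norm] at h3
  refine h3.trans ?_
  gcongr with n
  exact hd n

end Schur

/-! ### Upper and lower estimates for the coefficients at integer characters. -/

section PeriodicFrame

variable {ι : Type*}

/-- Schur's test with constant kernel $1$. Recentring the inner sum at the point $y+n$ makes the
bound a periodization, so that integrating over the cube unfolds it. -/
theorem tsum_enorm_periodization_sq_le (f Ψ : (ι → ℝ) → ℂ) (y : ι → ℝ) :
    (∑' n : ι → ℤ, ‖f (y + intVec n) * Ψ (y + intVec n)‖ₑ) ^ 2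
      ≤ 2 * ∑' n : ι → ℤ, ‖f (y + intVec n)‖ₑ ^ 2
        * (‖Ψ (y + intVec n)‖ₑ * ∑' m : ι → ℤ, ‖Ψ (y + intVec n + intVec m)‖ₑ) := by
  have h := tsum_tsum_mul_le_schur (κ := ι → ℤ) (fun _ _ => 1) (fun _ _ => rfl)
    (fun n => ‖f (y + intVec n)‖ₑ) (fun n => ‖Ψ (y + intVec n)‖ₑ)
  simp only [one_mul] at h
  rw [ENNReal.tsum_mul_right, ← sq] at h
  simp only [enorm_mul]
  refine h.trans (le_of_eq ?_)
  congr 1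
  refine tsum_congr fun n => ?_
  congr 2
  rw [← (Equiv.addLeft n).tsum_eq fun m => ‖Ψ (y + intVec m)‖ₑ]
  simp [intVec_add, add_assoc]

variable [Fintype ι] {f Ψ : (ι → ℝ) → ℂ} {K : ENNReal}

theorem measurable_tsum_enorm (hΨ : Measurable Ψ) :
    Measurable fun y => ∑' n : ι → ℤ, ‖Ψ (y + intVec n)‖ₑ :=
  Measurable.tsum fun _ => (hΨ.comp (measurable_add_const _)).enorm

theorem measurable_tsum_ne_zero_enorm [DecidableEq ι] (hΨ : Measurable Ψ) :
    Measurable fun y => ∑' n : ι → ℤ, (if n = 0 then 0 else 1) * ‖Ψ (y + intVec n)‖ₑ :=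
  Measurable.tsum fun _ => (hΨ.comp (measurable_add_const _)).enorm.const_mul _

theorem lintegral_unitCube_tsum_sq_le (hf : Measurable f) (hΨ : Measurable Ψ) :
    ∫⁻ y in unitCube ι, (∑' n : ι → ℤ, ‖f (y + intVec n) * Ψ (y + intVec n)‖ₑ) ^ 2
      ≤ 2 * ∫⁻ y, ‖f y‖ₑ ^ 2 * (‖Ψ y‖ₑ * ∑' n : ι → ℤ, ‖Ψ (y + intVec n)‖ₑ) := by
  have hm : Measurable fun y => ‖f y‖ₑ ^ 2 * (‖Ψ y‖ₑ * ∑' n : ι → ℤ, ‖Ψ (y + intVec n)‖ₑ) :=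
    (hf.enorm.pow_const 2).mul (hΨ.enorm.mul (measurable_tsum_enorm hΨ))
  calc _ ≤ ∫⁻ y in unitCube ι, 2 * ∑' n : ι → ℤ, ‖f (y + intVec n)‖ₑ ^ 2
        * (‖Ψ (y + intVec n)‖ₑ * ∑' m : ι → ℤ, ‖Ψ (y + intVec n + intVec m)‖ₑ) :=
      lintegral_mono fun y => tsum_enorm_periodization_sq_le f Ψ y
    _ = _ := by
      rw [lintegral_const_mul' _ _ ENNReal.ofNat_ne_top, lintegral_unitCube_tsum hm]

theorem lintegral_mul_ne_top (hf2 : ∫⁻ y, ‖f y‖ₑ ^ 2 ≠ ⊤) (hK : K ≠ ⊤)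
    (hΨK : ∀ y, ‖Ψ y‖ₑ * ∑' n : ι → ℤ, ‖Ψ (y + intVec n)‖ₑ ≤ K) :
    ∫⁻ y, ‖f y‖ₑ ^ 2 * (‖Ψ y‖ₑ * ∑' n : ι → ℤ, ‖Ψ (y + intVec n)‖ₑ) ≠ ⊤ := by
  refine (lt_of_le_of_lt (lintegral_mono (g := fun y => ‖f y‖ₑ ^ 2 * K) fun y => ?_) ?_).ne
  · exact mul_le_mul_right (hΨK y) _
  · rw [lintegral_mul_const' _ _ hK]
    exact ENNReal.mul_lt_top hf2.lt_top hK.lt_top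

/-- The uniform bound $K$ serves only to make the periodization square integrable, so that Parseval
applies; it does not enter the estimate. -/
theorem tsum_enorm_sq_intChar_le (hf : Measurable f) (hΨ : Measurable Ψ)
    (hf2 : ∫⁻ y, ‖f y‖ₑ ^ 2 ≠ ⊤) (hK : K ≠ ⊤)
    (hΨK : ∀ y, ‖Ψ y‖ₑ * ∑' n : ι → ℤ, ‖Ψ (y + intVec n)‖ₑ ≤ K) :
    ∑' m : ι → ℤ, ‖∫ y, intChar (-m) y * (f y * Ψ y)‖ₑ ^ 2
      ≤ 2 * ∫⁻ y, ‖f y‖ₑ ^ 2 * (‖Ψ y‖ₑ * ∑' n : ι → ℤ, ‖Ψ (y + intVec n)‖ₑ) := by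
  have h1 := lintegral_unitCube_tsum_sq_le hf hΨ
  have h2 := lintegral_mul_ne_top hf2 hK hΨK
  have h3 := (tsum_enorm_sq_integral_intChar (hf.mul hΨ)
    (ne_top_of_le_ne_top (ENNReal.mul_ne_top ENNReal.ofNat_ne_top h2) h1)).2
  simp only [Pi.mul_apply] at h3
  rw [h3]
  refine le_trans (lintegral_mono fun y => ?_) h1
  gcongr
  exact enorm_tsum_le_tsum_enorm

/-- On almost every fibre the diagonal is separated by `tsum_enorm_sq_le`; Schur's test then handles
the remaining interactions, and Parseval identifies the square of the periodization. -/
theorem lintegral_le_tsum_enorm_sq_intChar [DecidableEq ι] (hf : Measurable f) (hΨ : Measurable Ψ)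
    (hf2 : ∫⁻ y, ‖f y‖ₑ ^ 2 ≠ ⊤) (hK : K ≠ ⊤)
    (hΨK : ∀ y, ‖Ψ y‖ₑ * ∑' n : ι → ℤ, ‖Ψ (y + intVec n)‖ₑ ≤ K) :
    ∫⁻ y, ‖f y‖ₑ ^ 2 * ‖Ψ y‖ₑ ^ 2
      ≤ ∑' m : ι → ℤ, ‖∫ y, intChar (-m) y * (f y * Ψ y)‖ₑ ^ 2
        + 2 * ∫⁻ y, ‖f y‖ₑ ^ 2
          * (‖Ψ y‖ₑ * ∑' n : ι → ℤ, (if n = 0 then 0 else 1) * ‖Ψ (y + intVec n)‖ₑ) := by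
  have h1 := lintegral_unitCube_tsum_sq_le hf hΨ
  have h2 := lintegral_mul_ne_top hf2 hK hΨK
  obtain ⟨hint, h3⟩ := tsum_enorm_sq_integral_intChar (hf.mul hΨ)
    (ne_top_of_le_ne_top (ENNReal.mul_ne_top ENNReal.ofNat_ne_top h2) h1)
  have hae := ae_unitCube_tsum_lt_top (hf.mul hΨ).enorm (by simpa [HasFiniteIntegral] using hint.2.ne)
  have hm : Measurable fun y => ‖f y‖ₑ ^ 2
      * (‖Ψ y‖ₑ * ∑' n : ι → ℤ, (if n = 0 then 0 else 1) * ‖Ψ (y + intVec n)‖ₑ) :=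
    (hf.enorm.pow_const 2).mul (hΨ.enorm.mul (measurable_tsum_ne_zero_enorm hΨ))
  have hm2 : Measurable fun y => ‖f y‖ₑ ^ 2 * ‖Ψ y‖ₑ ^ 2 :=
    (hf.enorm.pow_const 2).mul (hΨ.enorm.pow_const 2)
  simp only [Pi.mul_apply] at h3 hae
  rw [h3, ← lintegral_unitCube_tsum hm, ← lintegral_unitCube_tsum hm2,
    ← lintegral_const_mul' _ _ ENNReal.ofNat_ne_top, ← lintegral_add_right]
  · refine lintegral_mono_ae ?_
    filter_upwards [hae] with y hy
    have h4 := tsum_enorm_sq_le hy.ne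
    simp only [enorm_mul, mul_pow] at h4
    refine h4.trans ?_
    gcongr ?_ + ?_
    · rfl
    -- The kernel that removes the diagonal becomes the condition $n\ne0$ after recentring.
    have h5 := tsum_tsum_mul_le_schur (κ := ι → ℤ) (fun m n => if n = m then 0 else 1)
      (fun m n => by simp only [eq_comm]) (fun n => ‖f (y + intVec n)‖ₑ)
      (fun n => ‖Ψ (y + intVec n)‖ₑ)
    refine h5.trans (le_of_eq ?_)
    congr 1
    refine tsum_congr fun n => ?_
    congr 2
    rw [← (Equiv.addLeft n).tsum_eq]
    simp [intVec_add, add_assoc]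
  · exact (Measurable.tsum fun n => hm.comp (measurable_add_const _)).const_mul 2

end PeriodicFrame

/-! ### Decay estimates, the summable envelope and sparse lattices. -/

section Decay

/-- The function `(1 + |x|) ^ (-s)`. -/
def decay (s x : ℝ) : ℝ := (1 + |x|) ^ (-s)

theorem decay_pos (s x : ℝ) : 0 < decay s x := by
  unfold decay
  positivity

theorem decay_le_one {s : ℝ} (hs : 0 ≤ s) (x : ℝ) : decay s x ≤ 1 :=
  Real.rpow_le_one_of_one_le_of_nonpos (by linarith [abs_nonneg x]) (by linarith)

theorem measurable_decay (s : ℝ) : Measurable (decay s) := by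
  unfold decay
  fun_prop

theorem decay_anti {s t : ℝ} (h : s ≤ t) (x : ℝ) : decay t x ≤ decay s x :=
  Real.rpow_le_rpow_of_exponent_le (by linarith [abs_nonneg x]) (by linarith)

/-- Since $|\omega|\le|x|+|x+\omega|$, one has $(1+|x|)(1+|x+\omega|)\ge1+|\omega|$. Part of the
exponent is thus spent on decay in the displacement alone. -/
theorem decay_mul_decay_le {s t : ℝ} (ht : 0 ≤ t) (x ω : ℝ) :
    decay (s + t) x * decay (s + t) (x + ω) ≤ decay t ω * (decay s x * decay s (x + ω)) := by
  have h1 : ∀ z, decay (s + t) z = decay s z * decay t z := by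
    intro z
    unfold decay
    rw [neg_add, Real.rpow_add (by positivity)]
  have h2 : decay t x * decay t (x + ω) ≤ decay t ω := by
    unfold decay
    rw [← Real.mul_rpow (by positivity) (by positivity)]
    refine Real.rpow_le_rpow_of_nonpos (by positivity) ?_ (by linarith)
    have : |ω| ≤ |x| + |x + ω| := by
      calc |ω| = |(x + ω) - x| := by ring_nf
        _ ≤ |x + ω| + |x| := abs_sub _ _
        _ = _ := add_comm _ _
    nlinarith [abs_nonneg x, abs_nonneg (x + ω)]
  rw [h1, h1]
  have := (decay_pos s x).le
  have := (decay_pos s (x + ω)).le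
  calc _ = (decay t x * decay t (x + ω)) * (decay s x * decay s (x + ω)) := by ring
    _ ≤ _ := by gcongr

theorem summable_decay {s : ℝ} (hs : 1 < s) : Summable fun k : ℤ => decay s k := by
  have h1 : Summable fun k : ℤ => |(k : ℝ)| ^ (-s) + if k = 0 then (1 : ℝ) else 0 :=
    (Real.summable_abs_int_rpow hs).add (summable_of_ne_finset_zero (s := {0}) (by simp))
  refine Summable.of_nonneg_of_le (fun k => (decay_pos s k).le) (fun k => ?_) h1
  rcases eq_or_ne k 0 with rfl | hk
  · simp [decay, Real.zero_rpow (by linarith : -s ≠ 0)]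
  · rw [if_neg hk, add_zero]
    have : 0 < |(k : ℝ)| := by positivity
    exact Real.rpow_le_rpow_of_nonpos this (by linarith) (by linarith)

/-- With $\tau=\min(1,|t|)$ one has $1+|r+kt|\ge\frac\tau4(1+|k|)$, because $|r|$ is at most half a
step. The loss $\tau^{-s}$ is rounded up to $\tau^{-2}$. -/
theorem decay_add_mul_le {s : ℝ} (hs0 : 0 ≤ s) (hs2 : s ≤ 2) {r t : ℝ} (ht : t ≠ 0)
    (hr : |r| ≤ |t| / 2) (k : ℤ) :
    decay s (r + k * t) ≤ 16 * (1 + (t ^ 2)⁻¹) * decay s k := by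
  set τ : ℝ := min 1 |t| with hτ
  have hτ0 : 0 < τ := lt_min one_pos (abs_pos.2 ht)
  have hτ1 : τ ≤ 1 := min_le_left _ _
  have hτt : τ ≤ |t| := min_le_right _ _
  have h1 : τ / 4 * (1 + |(k : ℝ)|) ≤ 1 + |r + k * t| := by
    rcases eq_or_ne k 0 with rfl | hk
    · simp only [Int.cast_zero, abs_zero, zero_mul, add_zero, mul_one]
      linarith [abs_nonneg r]
    · have hk1 : (1 : ℝ) ≤ |(k : ℝ)| := by exact_mod_cast Int.one_le_abs hk
      have h2 : |(k : ℝ)| * |t| ≤ |r + k * t| + |r| := by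
        rw [← abs_mul]
        calc |(k : ℝ) * t| = |(r + k * t) - r| := by ring_nf
          _ ≤ _ := abs_sub _ _
      nlinarith [abs_nonneg t]
  have h2 : decay s (r + k * t) ≤ (τ / 4) ^ (-s) * decay s k := by
    unfold decay
    rw [← Real.mul_rpow (by positivity) (by positivity)]
    exact Real.rpow_le_rpow_of_nonpos (by positivity) h1 (by linarith)
  refine h2.trans ?_
  have := (decay_pos s k).le
  gcongr
  calc (τ / 4) ^ (-s) ≤ (τ / 4) ^ (-2 : ℝ) :=
        Real.rpow_le_rpow_of_exponent_ge (by positivity) (by linarith) (by linarith)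
    _ = 16 * (τ ^ 2)⁻¹ := by
      rw [Real.rpow_neg (by positivity), Real.rpow_two, div_pow, inv_div]
      ring
    _ ≤ _ := by
      gcongr
      rcases min_choice 1 |t| with h | h
      · rw [hτ, h]
        have : 0 ≤ (t ^ 2)⁻¹ := by positivity
        simpa using this
      · rw [hτ, h, sq_abs]
        linarith

theorem exists_tsum_decay_le {s : ℝ} (hs1 : 1 < s) (hs2 : s ≤ 2) :
    ∃ K : ℝ, 0 < K ∧ ∀ t : ℝ, t ≠ 0 → ∀ y : ℝ,
      -- Re-indexing by the nearest integer to $y/t$ reduces to $|y|\le|t|/2$, which is why the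
      -- bound is uniform in $y$.
      ∑' k : ℤ, ENNReal.ofReal (decay s (y + k * t)) ≤ ENNReal.ofReal (K * (1 + (t ^ 2)⁻¹)) := by
  have hsum := summable_decay hs1
  have hpos : 0 < ∑' k : ℤ, decay s k :=
    hsum.tsum_pos (fun k => (decay_pos s k).le) 0 (decay_pos s _)
  refine ⟨16 * ∑' k : ℤ, decay s k, by positivity, fun t ht y => ?_⟩
  set k₀ : ℤ := round (y / t)
  have hr : |y - k₀ * t| ≤ |t| / 2 := by
    have h := abs_sub_round (y / t)
    have h2 : y - k₀ * t = (y / t - k₀) * t := by field_simp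
    rw [h2, abs_mul]
    nlinarith [abs_nonneg t]
  rw [← (Equiv.subRight k₀).tsum_eq fun k : ℤ => ENNReal.ofReal (decay s (y + k * t))]
  calc ∑' k : ℤ, ENNReal.ofReal (decay s (y + ((Equiv.subRight k₀ k : ℤ) : ℝ) * t))
      ≤ ∑' k : ℤ, ENNReal.ofReal (16 * (1 + (t ^ 2)⁻¹) * decay s k) := by
        refine ENNReal.tsum_le_tsum fun k => ENNReal.ofReal_le_ofReal ?_
        have h := decay_add_mul_le (by linarith) hs2 ht hr k
        refine le_trans (le_of_eq ?_) h
        congr 1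
        simp only [Equiv.subRight_apply]
        push_cast
        ring
    _ = ENNReal.ofReal (16 * (1 + (t ^ 2)⁻¹) * ∑' k : ℤ, decay s k) := by
        rw [← ENNReal.ofReal_tsum_of_nonneg
          (fun k : ℤ => mul_nonneg (by positivity) (decay_pos s k).le) (hsum.mul_left _), tsum_mul_left]
    _ = _ := by congr 1; ring

/-- For $2^J\le x<2^{J+1}$ the term of index $j$ is at most $2\cdot2^{-|j-J|}$. The exponent $J$ may
be negative, hence the comparison with a series over $\mathbb Z$. -/
theorem exists_tsum_min_dyadic_le :
    ∃ K : ℝ, 0 < K ∧ ∀ x : ℝ, 0 < x →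
      ∑' j : ℕ, ENNReal.ofReal (min (x / 2 ^ j) (2 ^ j / x)) ≤ ENNReal.ofReal K := by
  have hsum : Summable fun i : ℤ => (1 / 2 : ℝ) ^ i.natAbs := by
    have h := summable_geometric_of_lt_one (r := (1 / 2 : ℝ)) (by norm_num) (by norm_num)
    exact Summable.of_nat_of_neg (by simpa using h) (by simpa using h)
  have hpos : 0 < ∑' i : ℤ, (1 / 2 : ℝ) ^ i.natAbs :=
    hsum.tsum_pos (fun _ => by positivity) 0 (by simp)
  refine ⟨2 * ∑' i : ℤ, (1 / 2 : ℝ) ^ i.natAbs, by positivity, fun x hx => ?_⟩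
  obtain ⟨J, hJ1, hJ2⟩ := exists_mem_Ico_zpow hx (one_lt_two : (1 : ℝ) < 2)
  have hterm : ∀ j : ℕ, min (x / 2 ^ j) (2 ^ j / x) ≤ 2 * (1 / 2 : ℝ) ^ ((j : ℤ) - J).natAbs := by
    intro j
    have hj : (2 : ℝ) ^ j = 2 ^ (j : ℤ) := (zpow_natCast _ _).symm
    have hhalf : (1 / 2 : ℝ) ^ ((j : ℤ) - J).natAbs = 2 ^ (-(((j : ℤ) - J).natAbs : ℤ)) := by
      rw [zpow_neg, zpow_natCast, one_div, inv_pow]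
    rw [hhalf, hj]
    rcases le_total J (j : ℤ) with h | h
    · refine (min_le_left _ _).trans ?_
      have e : -((((j : ℤ) - J).natAbs : ℕ) : ℤ) = J - j := by omega
      rw [e, div_le_iff₀ (by positivity), mul_assoc, ← zpow_add₀ two_ne_zero, sub_add_cancel,
        ← zpow_one_add₀ two_ne_zero, add_comm]
      exact hJ2.le
    · refine (min_le_right _ _).trans ?_
      have e : -((((j : ℤ) - J).natAbs : ℕ) : ℤ) = j - J := by omega
      rw [e, div_le_iff₀ hx]
      calc (2 : ℝ) ^ (j : ℤ) = 2 ^ ((j : ℤ) - J) * 2 ^ J := by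
            rw [← zpow_add₀ two_ne_zero, sub_add_cancel]
        _ ≤ 2 ^ ((j : ℤ) - J) * x := by gcongr
        _ ≤ _ := by
          have : 0 < (2 : ℝ) ^ ((j : ℤ) - J) * x := by positivity
          linarith
  calc _ ≤ ∑' j : ℕ, ENNReal.ofReal (2 * (1 / 2 : ℝ) ^ ((j : ℤ) - J).natAbs) :=
        ENNReal.tsum_le_tsum fun j => ENNReal.ofReal_le_ofReal (hterm j)
    _ ≤ ∑' i : ℤ, ENNReal.ofReal (2 * (1 / 2 : ℝ) ^ i.natAbs) :=
        ENNReal.tsum_comp_le_tsum_of_injective (f := fun j : ℕ => (j : ℤ) - J)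
          (fun a b h => by simpa using h)
          (fun i : ℤ => ENNReal.ofReal (2 * (1 / 2 : ℝ) ^ i.natAbs))
    _ = _ := by
        rw [← ENNReal.ofReal_tsum_of_nonneg (fun _ => by positivity) (hsum.mul_left _),
          tsum_mul_left]

/-- An envelope for the products of the shearlet with its translates on the frequency side. -/
def envelope (x y : ℝ) : ℝ := min 1 (|x| ^ 3) * decay (9 / 8) x * decay (9 / 8) y

theorem envelope_nonneg (x y : ℝ) : 0 ≤ envelope x y :=
  mul_nonneg (mul_nonneg (le_min zero_le_one (by positivity)) (decay_pos _ _).le) (decay_pos _ _).le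

theorem envelope_le_one (x y : ℝ) : envelope x y ≤ 1 := by
  have h1 := decay_le_one (by norm_num : (0 : ℝ) ≤ 9 / 8) x
  have h2 := decay_le_one (by norm_num : (0 : ℝ) ≤ 9 / 8) y
  have h3 : min 1 (|x| ^ 3) ≤ 1 := min_le_left _ _
  have h4 : 0 ≤ min 1 (|x| ^ 3) := le_min zero_le_one (by positivity)
  exact mul_le_one₀ (mul_le_one₀ h3 (decay_pos _ _).le h1) (decay_pos _ _).le h2

theorem measurable_envelope : Measurable fun p : ℝ × ℝ => envelope p.1 p.2 := by
  have := measurable_decay (9 / 8)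
  unfold envelope
  fun_prop

/-- Near $0$ the cubic zero absorbs the singularity $x^{-2}$ and leaves a factor $|x|$; at infinity
the decay exponent exceeds $1$. Both ends are then summable over dyadic dilations. -/
theorem min_cube_mul_decay_mul_le {x : ℝ} (hx : x ≠ 0) :
    min 1 (|x| ^ 3) * decay (9 / 8) x * (1 + (x ^ 2)⁻¹) ≤ 2 * min |x| (1 / |x|) := by
  have hx0 : 0 < |x| := abs_pos.2 hx
  have hd1 := decay_le_one (by norm_num : (0 : ℝ) ≤ 9 / 8) x
  have hd0 := (decay_pos (9 / 8) x).le
  rw [← sq_abs x]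
  rcases le_total |x| 1 with h | h
  · have h3 : min |x| (1 / |x|) = |x| := min_eq_left (h.trans ((one_le_div hx0).2 h))
    rw [h3]
    calc min 1 (|x| ^ 3) * decay (9 / 8) x * (1 + (|x| ^ 2)⁻¹)
        ≤ |x| ^ 3 * 1 * (1 + (|x| ^ 2)⁻¹) := by
          gcongr
          exact min_le_right _ _
      _ = |x| ^ 3 + |x| := by field_simp
      _ ≤ _ := by nlinarith [pow_le_of_le_one hx0.le h (three_ne_zero)]
  · have h3 : min |x| (1 / |x|) = 1 / |x| := min_eq_right (((div_le_one hx0).2 h).trans h)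
    rw [h3]
    have hd : decay (9 / 8) x ≤ 1 / |x| := by
      refine (decay_anti (by norm_num : (1 : ℝ) ≤ 9 / 8) x).trans ?_
      unfold decay
      rw [Real.rpow_neg (by positivity), Real.rpow_one, inv_eq_one_div]
      gcongr
      linarith
    have hi : (|x| ^ 2)⁻¹ ≤ 1 := inv_le_one_of_one_le₀ (one_le_pow₀ h)
    calc min 1 (|x| ^ 3) * decay (9 / 8) x * (1 + (|x| ^ 2)⁻¹)
        ≤ 1 * (1 / |x|) * (1 + 1) := by
          gcongr
          exact min_le_left _ _
      _ = _ := by ring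

/-- The shears shift the second coordinate in steps of $t=2^{-j}x$, so their sum costs $1+t^{-2}$,
which the first-coordinate factor compensates. The offset $y$ may depend on $j$ because the second
frequency is scaled by $2^{-j/2}$. -/
theorem exists_tsum_envelope_le :
    ∃ K : ℝ, 0 < K ∧ ∀ (x : ℝ) (y : ℕ → ℝ),
      ∑' j : ℕ, ∑' k : ℤ, ENNReal.ofReal (envelope ((2 ^ j)⁻¹ * x) (y j + k * ((2 ^ j)⁻¹ * x)))
        ≤ ENNReal.ofReal K := by
  obtain ⟨K₁, hK₁, h1⟩ := exists_tsum_decay_le (s := 9 / 8) (by norm_num) (by norm_num)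
  obtain ⟨K₂, hK₂, h2⟩ := exists_tsum_min_dyadic_le
  refine ⟨K₁ * 2 * K₂, by positivity, fun x y => ?_⟩
  rcases eq_or_ne x 0 with rfl | hx
  · simp [envelope]
  have hterm : ∀ j : ℕ, ∑' k : ℤ,
      ENNReal.ofReal (envelope ((2 ^ j)⁻¹ * x) (y j + k * ((2 ^ j)⁻¹ * x)))
        ≤ ENNReal.ofReal (K₁ * 2) * ENNReal.ofReal (min (|x| / 2 ^ j) (2 ^ j / |x|)) := by
    intro j
    set t : ℝ := (2 ^ j)⁻¹ * x with ht
    have ht0 : t ≠ 0 := by positivity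
    have habs : |t| = |x| / 2 ^ j := by
      rw [ht, abs_mul, abs_of_pos (by positivity : (0 : ℝ) < (2 ^ j)⁻¹)]
      ring
    have hm : 0 ≤ min 1 (|t| ^ 3) * decay (9 / 8) t :=
      mul_nonneg (le_min zero_le_one (by positivity)) (decay_pos _ _).le
    simp_rw [envelope, ENNReal.ofReal_mul hm, ENNReal.tsum_mul_left]
    calc _ ≤ ENNReal.ofReal (min 1 (|t| ^ 3) * decay (9 / 8) t)
          * ENNReal.ofReal (K₁ * (1 + (t ^ 2)⁻¹)) := by
          gcongr
          exact h1 t ht0 (y j)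
      _ = ENNReal.ofReal (K₁ * (min 1 (|t| ^ 3) * decay (9 / 8) t * (1 + (t ^ 2)⁻¹))) := by
          rw [← ENNReal.ofReal_mul hm]
          congr 1
          ring
      _ ≤ ENNReal.ofReal (K₁ * (2 * min |t| (1 / |t|))) := by
          refine ENNReal.ofReal_le_ofReal (mul_le_mul_of_nonneg_left ?_ hK₁.le)
          exact min_cube_mul_decay_mul_le ht0
      _ = _ := by
          rw [← ENNReal.ofReal_mul (by positivity), habs, one_div_div, mul_assoc]
  calc _ ≤ ∑' j : ℕ, ENNReal.ofReal (K₁ * 2) * ENNReal.ofReal (min (|x| / 2 ^ j) (2 ^ j / |x|)) :=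
        ENNReal.tsum_le_tsum hterm
    _ ≤ ENNReal.ofReal (K₁ * 2) * ENNReal.ofReal K₂ := by
        rw [ENNReal.tsum_mul_left]
        gcongr
        exact h2 _ (abs_pos.2 hx)
    _ = _ := (ENNReal.ofReal_mul (by positivity)).symm

theorem exists_tsum_decay_prod_le :
    ∃ K : ℝ, 0 < K ∧ ∀ c₁ c₂ : ℝ, 0 < c₁ → c₁ ≤ 1 → 0 < c₂ → c₂ ≤ 1 → ∀ x y : ℝ,
      ∑' n : Fin 2 → ℤ, ENNReal.ofReal (decay (9 / 8) (x + n 0 / c₁) * decay (9 / 8) (y + n 1 / c₂))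
        ≤ ENNReal.ofReal K := by
  obtain ⟨K, hK, h⟩ := exists_tsum_decay_le (s := 9 / 8) (by norm_num) (by norm_num)
  have h' : ∀ c : ℝ, 0 < c → c ≤ 1 → ∀ x : ℝ,
      ∑' k : ℤ, ENNReal.ofReal (decay (9 / 8) (x + k / c)) ≤ ENNReal.ofReal (K * 2) := by
    intro c hc hc1 x
    have := h c⁻¹ (by positivity) x
    simp only [← div_eq_mul_inv] at this
    refine this.trans (ENNReal.ofReal_le_ofReal ?_)
    gcongr
    rw [inv_pow, inv_inv]
    have := pow_le_one₀ hc.le hc1 (n := 2)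
    linarith
  refine ⟨(K * 2) * (K * 2), by positivity, fun c₁ c₂ h1 h1' h2 h2' x y => ?_⟩
  rw [← (finTwoArrowEquiv ℤ).symm.tsum_eq]
  simp only [finTwoArrowEquiv_symm_apply, Matrix.cons_val_zero, Matrix.cons_val_one,
    ENNReal.ofReal_mul (decay_pos _ _).le]
  rw [ENNReal.tsum_prod (f := fun a b : ℤ => ENNReal.ofReal (decay (9 / 8) (x + a / c₁))
    * ENNReal.ofReal (decay (9 / 8) (y + b / c₂)))]
  simp_rw [ENNReal.tsum_mul_left, ENNReal.tsum_mul_right]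
  rw [ENNReal.ofReal_mul (by positivity)]
  gcongr
  · exact h' c₁ h1 h1' x
  · exact h' c₂ h2 h2' y

variable {G : ℝ → ℝ → ℂ} {C : ℝ}

/-- The split $5/4=9/8+1/8$ in both variables: the $1/8$ gives decay in the displacement, the $9/8$
at the first point forms the envelope, and the $9/8$ at the second remains summable over the
lattice. -/
theorem norm_mul_norm_translate_le (hC : 0 ≤ C)
    (hG : ∀ x y, ‖G x y‖ ≤ C * (min 1 (|x| ^ 3) * decay (5 / 4) x * decay (5 / 4) y))
    (x y ω₁ ω₂ : ℝ) :
    ‖G x y‖ * ‖G (x + ω₁) (y + ω₂)‖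
      ≤ C ^ 2 * envelope x y * (decay (1 / 8) ω₁ * decay (1 / 8) ω₂)
        * (decay (9 / 8) (x + ω₁) * decay (9 / 8) (y + ω₂)) := by
  have e : (5 / 4 : ℝ) = 9 / 8 + 1 / 8 := by norm_num
  have h1 := decay_mul_decay_le (s := 9 / 8) (t := 1 / 8) (by norm_num) x ω₁
  have h2 := decay_mul_decay_le (s := 9 / 8) (t := 1 / 8) (by norm_num) y ω₂
  rw [← e] at h1 h2
  have hm : ∀ z : ℝ, 0 ≤ min 1 (|z| ^ 3) := fun z => le_min zero_le_one (by positivity)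
  have hd : ∀ s z : ℝ, 0 ≤ decay s z := fun s z => (decay_pos s z).le
  have hGm : ‖G (x + ω₁) (y + ω₂)‖ ≤ C * (decay (5 / 4) (x + ω₁) * decay (5 / 4) (y + ω₂)) := by
    refine (hG _ _).trans ?_
    have := hd (5 / 4) (x + ω₁)
    have := hd (5 / 4) (y + ω₂)
    rw [mul_assoc (min _ _)]
    refine mul_le_mul_of_nonneg_left ?_ hC
    exact mul_le_of_le_one_left (mul_nonneg (hd _ _) (hd _ _)) (min_le_left _ _)
  calc _ ≤ C * (min 1 (|x| ^ 3) * decay (5 / 4) x * decay (5 / 4) y)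
        * (C * (decay (5 / 4) (x + ω₁) * decay (5 / 4) (y + ω₂))) :=
        mul_le_mul (hG x y) hGm (norm_nonneg _) ((norm_nonneg _).trans (hG x y))
    _ = C ^ 2 * min 1 (|x| ^ 3) * ((decay (5 / 4) x * decay (5 / 4) (x + ω₁))
        * (decay (5 / 4) y * decay (5 / 4) (y + ω₂))) := by ring
    _ ≤ C ^ 2 * min 1 (|x| ^ 3) * ((decay (1 / 8) ω₁ * (decay (9 / 8) x * decay (9 / 8) (x + ω₁)))
        * (decay (1 / 8) ω₂ * (decay (9 / 8) y * decay (9 / 8) (y + ω₂)))) := by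
        refine mul_le_mul_of_nonneg_left (mul_le_mul h1 h2 ?_ ?_)
          (mul_nonneg (sq_nonneg _) (hm x))
        · exact mul_nonneg (hd _ _) (hd _ _)
        · exact mul_nonneg (hd _ _) (mul_nonneg (hd _ _) (hd _ _))
    _ = _ := by unfold envelope; ring

/-- A nonzero lattice vector has a coordinate of size at least $1/c$; the decay factor in the other
coordinate is at most $1$. -/
theorem decay_mul_decay_lattice_le {c c₁ c₂ : ℝ} (h1 : 0 < c₁) (h1' : c₁ ≤ c) (h2 : 0 < c₂)
    (h2' : c₂ ≤ c) {n : Fin 2 → ℤ} (hn : n ≠ 0) :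
    decay (1 / 8) (n 0 / c₁) * decay (1 / 8) (n 1 / c₂) ≤ c ^ (1 / 8 : ℝ) := by
  have key : ∀ (k : ℤ) (b : ℝ), k ≠ 0 → 0 < b → b ≤ c → decay (1 / 8) (k / b) ≤ c ^ (1 / 8 : ℝ) := by
    intro k b hk hb hbc
    have hc : 0 < c := hb.trans_le hbc
    have hk1 : (1 : ℝ) ≤ |(k : ℝ)| := by exact_mod_cast Int.one_le_abs hk
    have h : c⁻¹ ≤ 1 + |(k : ℝ) / b| := by
      rw [abs_div, abs_of_pos hb, inv_eq_one_div]
      have : 1 / c ≤ |(k : ℝ)| / b := by gcongr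
      linarith
    calc decay (1 / 8) (k / b) ≤ (c⁻¹) ^ (-(1 / 8) : ℝ) :=
          Real.rpow_le_rpow_of_nonpos (by positivity) h (by norm_num)
      _ = _ := by rw [Real.inv_rpow hc.le, Real.rpow_neg hc.le, inv_inv]
  have hd1 : ∀ z, decay (1 / 8) z ≤ 1 := decay_le_one (by norm_num)
  by_cases h0 : n 0 = 0
  · have h : n 1 ≠ 0 := by
      intro h
      apply hn
      ext i
      fin_cases i <;> simp [h0, h]
    exact (mul_le_of_le_one_left (decay_pos _ _).le (hd1 _)).trans (key _ _ h h2 h2')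
  · exact (mul_le_of_le_one_right (decay_pos _ _).le (hd1 _)).trans (key _ _ h0 h1 h1')

/-- Translates of a decaying function along a sparse lattice: the total interaction is controlled
by the envelope, and the off-diagonal one is small. -/
theorem exists_tsum_translates_le (hC : 0 < C)
    (hG : ∀ x y, ‖G x y‖ ≤ C * (min 1 (|x| ^ 3) * decay (5 / 4) x * decay (5 / 4) y)) :
    ∃ K : ℝ, 0 < K ∧ ∀ c c₁ c₂ : ℝ, c ≤ 1 → 0 < c₁ → c₁ ≤ c → 0 < c₂ → c₂ ≤ c → ∀ x y : ℝ,
      ‖G x y‖ₑ * ∑' n : Fin 2 → ℤ, ‖G (x + n 0 / c₁) (y + n 1 / c₂)‖ₑ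
          ≤ ENNReal.ofReal K * ENNReal.ofReal (envelope x y) ∧
      ‖G x y‖ₑ * ∑' n : Fin 2 → ℤ, (if n = 0 then 0 else 1) * ‖G (x + n 0 / c₁) (y + n 1 / c₂)‖ₑ
          ≤ ENNReal.ofReal (K * c ^ (1 / 8 : ℝ)) * ENNReal.ofReal (envelope x y) := by
  obtain ⟨K, hK, h⟩ := exists_tsum_decay_prod_le
  refine ⟨C ^ 2 * K, by positivity, fun c c₁ c₂ hc h1 h1' h2 h2' x y => ?_⟩
  have hc0 : 0 < c := h1.trans_le h1'
  have hE := envelope_nonneg x y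
  have hsum := h c₁ c₂ h1 (h1'.trans hc) h2 (h2'.trans hc) x y
  have hdd : ∀ n : Fin 2 → ℤ, 0 ≤ decay (9 / 8) (x + n 0 / c₁) * decay (9 / 8) (y + n 1 / c₂) :=
    fun n => mul_nonneg (decay_pos _ _).le (decay_pos _ _).le
  have hterm : ∀ (n : Fin 2 → ℤ) (θ : ℝ), 0 ≤ θ →
      decay (1 / 8) (n 0 / c₁) * decay (1 / 8) (n 1 / c₂) ≤ θ →
      ‖G x y‖ₑ * ‖G (x + n 0 / c₁) (y + n 1 / c₂)‖ₑ
        ≤ ENNReal.ofReal (C ^ 2 * envelope x y * θ)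
          * ENNReal.ofReal (decay (9 / 8) (x + n 0 / c₁) * decay (9 / 8) (y + n 1 / c₂)) := by
    intro n θ hθ0 hθ
    rw [← ofReal_norm, ← ofReal_norm, ← ENNReal.ofReal_mul (norm_nonneg _),
      ← ENNReal.ofReal_mul (by positivity)]
    refine ENNReal.ofReal_le_ofReal ((norm_mul_norm_translate_le hC.le hG x y _ _).trans ?_)
    have := hdd n
    gcongr
  have hfin : ∀ θ : ℝ, 0 ≤ θ → ENNReal.ofReal (C ^ 2 * envelope x y * θ) * ENNReal.ofReal K
      = ENNReal.ofReal (C ^ 2 * K * θ) * ENNReal.ofReal (envelope x y) := by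
    intro θ hθ
    rw [← ENNReal.ofReal_mul (by positivity), ← ENNReal.ofReal_mul (by positivity)]
    congr 1
    ring
  constructor
  · rw [← ENNReal.tsum_mul_left]
    calc _ ≤ ∑' n : Fin 2 → ℤ, ENNReal.ofReal (C ^ 2 * envelope x y * 1)
          * ENNReal.ofReal (decay (9 / 8) (x + n 0 / c₁) * decay (9 / 8) (y + n 1 / c₂)) := by
          refine ENNReal.tsum_le_tsum fun n => hterm n 1 zero_le_one ?_
          exact mul_le_one₀ (decay_le_one (by norm_num) _) (decay_pos _ _).le
            (decay_le_one (by norm_num) _)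
      _ ≤ ENNReal.ofReal (C ^ 2 * envelope x y * 1) * ENNReal.ofReal K := by
          rw [ENNReal.tsum_mul_left]
          gcongr
      _ = _ := by rw [hfin 1 zero_le_one, mul_one]
  · rw [← ENNReal.tsum_mul_left]
    calc _ ≤ ∑' n : Fin 2 → ℤ, ENNReal.ofReal (C ^ 2 * envelope x y * c ^ (1 / 8 : ℝ))
          * ENNReal.ofReal (decay (9 / 8) (x + n 0 / c₁) * decay (9 / 8) (y + n 1 / c₂)) := by
          refine ENNReal.tsum_le_tsum fun n => ?_
          by_cases hn : n = 0
          · simp [hn]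
          · rw [if_neg hn, one_mul]
            exact hterm n _ (by positivity) (decay_mul_decay_lattice_le h1 h1' h2 h2' hn)
      _ ≤ ENNReal.ofReal (C ^ 2 * envelope x y * c ^ (1 / 8 : ℝ)) * ENNReal.ofReal K := by
          rw [ENNReal.tsum_mul_left]
          gcongr
      _ = _ := hfin _ (by positivity)

end Decay

/-! ### Upper and lower bounds for the Fourier transform of the shearlet. -/

section Symbol

/-- The function `(x, y) ↦ b̂(πx) φ̂(πx) φ̂(πy)`, i.e. the unitary Fourier transform of the
shearlet. -/
def shearletHat (a₁ a₂ : ℤ →₀ ℝ) (x y : ℝ) : ℂ :=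
  highPass a₁ (Real.pi * x) * refinableHat a₂ (Real.pi * x) * refinableHat a₂ (Real.pi * y)

variable {N₁ l₁ N₂ l₂ : ℕ} {a₁ a₂ : ℤ →₀ ℝ}

theorem measurable_shearletHat (h₂ : IsTypeIMask N₂ l₂ a₂) :
    Measurable fun p : ℝ × ℝ => shearletHat a₁ a₂ p.1 p.2 := by
  have := measurable_highPass a₁
  have := h₂.measurable_refinableHat
  unfold shearletHat
  fun_prop

theorem exists_norm_shearletHat_le (h₁ : IsTypeIMask N₁ l₁ a₁) (h₂ : IsTypeIMask N₂ l₂ a₂)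
    (hN₁ : 3 ≤ N₁) (hl₂ : l₂ < N₂) (hN₂ : 3 ≤ N₂) :
    ∃ C : ℝ, 0 < C ∧ ∀ x y, ‖shearletHat a₁ a₂ x y‖
      ≤ C * (min 1 (|x| ^ 3) * decay (5 / 4) x * decay (5 / 4) y) := by
  obtain ⟨D, hD, hφ⟩ := h₂.exists_norm_refinableHat_le hl₂ hN₂
  have hφ' : ∀ x, ‖refinableHat a₂ (Real.pi * x)‖ ≤ D * decay (5 / 4) x := by
    intro x
    refine (hφ _).trans ?_
    unfold decay
    gcongr ?_ * ?_
    refine Real.rpow_le_rpow_of_nonpos (by positivity) ?_ (by norm_num)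
    rw [abs_mul, abs_of_pos Real.pi_pos]
    nlinarith [Real.pi_gt_three, abs_nonneg x]
  set Q := √(pseudoSplinePoly N₁ l₁ 1) with hQ
  -- For $|x|\le1$ the zero of order $N_1\ge3$ is weakened to a cubic one; for $|x|\ge1$ the bound
  -- $|\hat b|\le1$ suffices.
  have hb : ∀ x, ‖highPass a₁ (Real.pi * x)‖ ≤ (1 + Q * Real.pi ^ N₁) * min 1 (|x| ^ 3) := by
    intro x
    have hQ0 : 0 ≤ Q * Real.pi ^ N₁ := by positivity
    rcases le_total |x| 1 with hx | hx
    · rw [min_eq_right (pow_le_one₀ (abs_nonneg x) hx)]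
      calc _ ≤ Q * |Real.pi * x| ^ N₁ := h₁.norm_highPass_le _
        _ = Q * Real.pi ^ N₁ * |x| ^ N₁ := by
          rw [abs_mul, abs_of_pos Real.pi_pos, mul_pow]
          ring
        _ ≤ (1 + Q * Real.pi ^ N₁) * |x| ^ 3 := by
          gcongr ?_ * ?_
          · linarith
          · exact pow_le_pow_of_le_one (abs_nonneg x) hx hN₁
    · rw [min_eq_left (one_le_pow₀ hx), mul_one]
      linarith [h₁.norm_highPass_le_one (by omega) (Real.pi * x)]
  refine ⟨(1 + Q * Real.pi ^ N₁) * D * D, by positivity, fun x y => ?_⟩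
  have hm : 0 ≤ min 1 (|x| ^ 3) := le_min zero_le_one (by positivity)
  have hd := (decay_pos (5 / 4) x).le
  unfold shearletHat
  rw [norm_mul, norm_mul]
  calc _ ≤ ((1 + Q * Real.pi ^ N₁) * min 1 (|x| ^ 3)) * (D * decay (5 / 4) x)
        * (D * decay (5 / 4) y) := by
        gcongr
        · exact hb x
        · exact hφ' x
        · exact hφ' y
    _ = _ := by ring

/-- Here $|\pi x|,|\pi y|\le\pi$, where each $\hat\phi$ is at least $(2/\pi)^{N_2}$, and
$\alpha/4\le\pi|x|/2\le\pi/2$, where the sine is increasing. -/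
theorem norm_shearletHat_ge (h₁ : IsTypeIMask N₁ l₁ a₁) (h₂ : IsTypeIMask N₂ l₂ a₂) {α x y : ℝ}
    (hα : 0 < α) (hαx : α ≤ 2 * Real.pi * |x|) (hx : |x| ≤ 1) (hy : |y| ≤ 1) :
    Real.sin (α / 4) ^ N₁ * ((2 / Real.pi) ^ N₂ * (2 / Real.pi) ^ N₂) ≤ ‖shearletHat a₁ a₂ x y‖ := by
  have hπ := Real.pi_pos
  have habs : ∀ z : ℝ, |z| ≤ 1 → |Real.pi * z| ≤ Real.pi := by
    intro z hz
    rw [abs_mul, abs_of_pos hπ]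
    exact mul_le_of_le_one_right hπ.le hz
  have hs0 : 0 ≤ Real.sin (α / 4) := by
    apply Real.sin_nonneg_of_nonneg_of_le_pi (by positivity)
    nlinarith
  have hs : Real.sin (α / 4) ≤ |Real.sin (Real.pi * x / 2)| := by
    have e : |Real.sin (Real.pi * x / 2)| = |Real.sin (Real.pi * |x| / 2)| := by
      rcases abs_choice x with e | e <;> rw [e]
      rw [mul_neg, neg_div, Real.sin_neg, abs_neg]
    rw [e]
    refine le_trans ?_ (le_abs_self _)
    apply Real.sin_le_sin_of_le_of_le_pi_div_two
    · linarith
    · nlinarith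
    · linarith
  unfold shearletHat
  rw [norm_mul, norm_mul, ← mul_assoc]
  gcongr
  · exact (pow_le_pow_left₀ hs0 hs N₁).trans (h₁.abs_sin_pow_le_norm_highPass _)
  · exact h₂.pow_le_norm_refinableHat (habs x hx)
  · exact h₂.pow_le_norm_refinableHat (habs y hy)

end Symbol

/-! ### Action of scales and shears on frequencies. -/

section Geometry

/-- The matrix `(S_k A_{2^j})⁻ᵀ`. -/
def dualMat (j : ℕ) (k : ℤ) : Matrix (Fin 2) (Fin 2) ℝ :=
  !![((2 : ℝ) ^ j)⁻¹, 0; -(k * ((2 : ℝ) ^ j)⁻¹), ((2 : ℝ) ^ ((j : ℝ) / 2))⁻¹]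

/-- For every frequency in the cones some admissible scale and shear moves it to the region where
the shearlet is large. -/
theorem exists_scale_shear {α x y : ℝ} (hα : 0 < α) (hα2 : α ≤ Real.pi)
    (hx : α ≤ 2 * Real.pi * |x|) (hxy : |y| ≤ |x|) :
    ∃ (j : ℕ) (k : ℤ), |k| ≤ ⌈(2 : ℝ) ^ ((j : ℝ) / 2)⌉ ∧ α ≤ 2 * Real.pi * |(2 ^ j)⁻¹ * x| ∧
      |(2 ^ j)⁻¹ * x| ≤ 1 ∧
      |((2 : ℝ) ^ ((j : ℝ) / 2))⁻¹ * y + k * ((2 ^ j)⁻¹ * x)| ≤ 1 := by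
  have hπ := Real.pi_pos
  have hx0 : 0 < |x| := by
    by_contra h
    have : |x| = 0 := le_antisymm (not_lt.1 h) (abs_nonneg x)
    rw [this] at hx
    linarith
  -- If $|x|\le1$ the scale $j=0$ works. Otherwise $|x|$ is brought into $[1/2,1]$, and
  -- $\alpha\le\pi$ gives the first inequality.
  obtain ⟨j, hj1, hj2⟩ : ∃ j : ℕ, α ≤ 2 * Real.pi * |(2 ^ j)⁻¹ * x| ∧ |(2 ^ j)⁻¹ * x| ≤ 1 := by
    rcases le_total |x| 1 with h1 | h1
    · exact ⟨0, by simpa using hx, by simpa using h1⟩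
    · obtain ⟨J, hJ1, hJ2⟩ := exists_nat_pow_near h1 (one_lt_two : (1 : ℝ) < 2)
      have h2 : |((2 : ℝ) ^ (J + 1))⁻¹ * x| = |x| / (2 ^ J * 2) := by
        rw [abs_mul, abs_of_pos (by positivity : (0 : ℝ) < (2 ^ (J + 1))⁻¹), pow_succ]
        ring
      refine ⟨J + 1, ?_, ?_⟩
      · rw [h2]
        have : 1 / 2 ≤ |x| / (2 ^ J * 2) := by
          rw [div_le_div_iff₀ (by norm_num) (by positivity)]
          linarith
        nlinarith
      · rw [h2, ← pow_succ]
        exact (div_le_one (by positivity)).2 hJ2.le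
  set t : ℝ := (2 ^ j)⁻¹ * x with ht
  set s : ℝ := (2 : ℝ) ^ ((j : ℝ) / 2) with hs
  have hs0 : 0 < s := by positivity
  have hss : s * s = 2 ^ j := by
    rw [hs, ← Real.rpow_add two_pos, add_halves, Real.rpow_natCast]
  have ht0 : t ≠ 0 := by
    rw [ht]
    exact mul_ne_zero (by positivity) (abs_pos.1 hx0)
  -- The best integer shear leaves at most $|t|/2$ in the second coordinate. It is admissible
  -- because $s^2=2^j$ turns the quotient into $s\,y/x$, and $|y/x|\le1$ on the cone.
  refine ⟨j, -round (s⁻¹ * y / t), ?_, hj1, hj2, ?_⟩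
  · have hle : |s⁻¹ * y / t| ≤ s := by
      have e : s⁻¹ * y / t = s * (y / x) := by
        rw [ht, ← hss]
        have : x ≠ 0 := abs_pos.1 hx0
        field_simp
      rw [e, abs_mul, abs_of_pos hs0, abs_div]
      exact mul_le_of_le_one_right hs0.le ((div_le_one hx0).2 hxy)
    have hr := abs_sub_round (s⁻¹ * y / t)
    have hc := Int.le_ceil s
    rw [abs_le] at hle hr
    change |-round (s⁻¹ * y / t)| ≤ ⌈s⌉
    rw [abs_neg, abs_le]
    constructor
    · have : (-(⌈s⌉ : ℝ) - 1) < round (s⁻¹ * y / t) := by linarith [hr.2]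
      have h : -⌈s⌉ - 1 < round (s⁻¹ * y / t) := by exact_mod_cast this
      omega
    · have : (round (s⁻¹ * y / t) : ℝ) < ⌈s⌉ + 1 := by linarith [hr.1]
      have h : round (s⁻¹ * y / t) < ⌈s⌉ + 1 := by exact_mod_cast this
      omega
  · have hr := abs_sub_round (s⁻¹ * y / t)
    have e : s⁻¹ * y + ((-round (s⁻¹ * y / t) : ℤ) : ℝ) * t
        = (s⁻¹ * y / t - round (s⁻¹ * y / t)) * t := by
      push_cast
      field_simp
      ring
    rw [e, abs_mul]
    calc _ ≤ (1 / 2 : ℝ) * 1 := by gcongr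
      _ ≤ 1 := by norm_num

variable (j : ℕ) (k : ℤ)

/-- The scale factor `det A_{2^j}`. -/
def scaleDet (j : ℕ) : ℝ := 2 ^ j * (2 : ℝ) ^ ((j : ℝ) / 2)

theorem scaleDet_pos : 0 < scaleDet j := by
  unfold scaleDet
  positivity

theorem det_shearMat_mul_scaleMat :
    (shearMat k * scaleMat j).det = scaleDet j := by
  simp [shearMat, scaleMat, scaleDet]

theorem det_dualMat : (dualMat j k).det = (scaleDet j)⁻¹ := by
  simp [dualMat, scaleDet, mul_comm]

/-- The invertible operator of a matrix with non-zero determinant. -/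
def matrixEquiv (M : Matrix (Fin 2) (Fin 2) ℝ) (hM : M.det ≠ 0) : Plane ≃L[ℝ] Plane :=
  (LinearEquiv.ofIsUnitDet (f := Matrix.toEuclideanLin M)
    (v := (EuclideanSpace.basisFun (Fin 2) ℝ).toBasis)
    (v' := (EuclideanSpace.basisFun (Fin 2) ℝ).toBasis)
    (by
      rw [Matrix.toEuclideanLin_eq_toLin_orthonormal, LinearMap.toMatrix_toLin]
      exact isUnit_iff_ne_zero.2 hM)).toContinuousLinearEquiv

theorem matrixEquiv_apply (M : Matrix (Fin 2) (Fin 2) ℝ) (hM : M.det ≠ 0) (x : Plane) :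
    matrixEquiv M hM x = Matrix.toEuclideanLin M x := rfl

theorem map_matrixEquiv (M : Matrix (Fin 2) (Fin 2) ℝ) (hM : M.det ≠ 0) :
    Measure.map (matrixEquiv M hM) volume = ENNReal.ofReal |M.det⁻¹| • (volume : Measure Plane) := by
  have hdet : LinearMap.det (Matrix.toEuclideanLin M : Plane →ₗ[ℝ] Plane) = M.det := by
    change LinearMap.det (Matrix.toLpLin 2 2 M) = _
    rw [Matrix.toLpLin_eq_toLin, LinearMap.det_toLin]
  have h := Measure.map_linearMap_addHaar_eq_smul_addHaar (volume : Measure Plane)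
    (f := Matrix.toEuclideanLin M) (by rwa [hdet])
  rw [hdet] at h
  exact h

theorem toEuclideanLin_apply_zero (M : Matrix (Fin 2) (Fin 2) ℝ) (x : Plane) :
    Matrix.toEuclideanLin M x 0 = M 0 0 * x 0 + M 0 1 * x 1 := by
  simp [Matrix.toEuclideanLin, Matrix.toLpLin_apply]

theorem toEuclideanLin_apply_one (M : Matrix (Fin 2) (Fin 2) ℝ) (x : Plane) :
    Matrix.toEuclideanLin M x 1 = M 1 0 * x 0 + M 1 1 * x 1 := by
  simp [Matrix.toEuclideanLin, Matrix.toLpLin_apply]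

/-- The operator of `S_k A_{2^j}`. -/
def shearEquiv : Plane ≃L[ℝ] Plane :=
  matrixEquiv (shearMat k * scaleMat j) (by
    rw [det_shearMat_mul_scaleMat]
    exact (scaleDet_pos j).ne')

/-- The operator of `(S_k A_{2^j})⁻ᵀ`. -/
def dualEquiv : Plane ≃L[ℝ] Plane :=
  matrixEquiv (dualMat j k) (by
    rw [det_dualMat]
    exact (inv_pos.2 (scaleDet_pos j)).ne')

theorem map_shearEquiv : Measure.map (shearEquiv j k) volume
    = ENNReal.ofReal (scaleDet j)⁻¹ • (volume : Measure Plane) := by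
  rw [shearEquiv, map_matrixEquiv, det_shearMat_mul_scaleMat,
    abs_of_pos (inv_pos.2 (scaleDet_pos j))]

theorem map_dualEquiv : Measure.map (dualEquiv j k) volume
    = ENNReal.ofReal (scaleDet j) • (volume : Measure Plane) := by
  rw [dualEquiv, map_matrixEquiv, det_dualMat, inv_inv, abs_of_pos (scaleDet_pos j)]

theorem dualEquiv_apply_zero (ξ : Plane) : dualEquiv j k ξ 0 = (2 ^ j)⁻¹ * ξ 0 := by
  rw [dualEquiv, matrixEquiv_apply, toEuclideanLin_apply_zero]
  simp [dualMat]

theorem dualEquiv_apply_one (ξ : Plane) :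
    dualEquiv j k ξ 1
      = ((2 : ℝ) ^ ((j : ℝ) / 2))⁻¹ * ξ 1 + ((-k : ℤ) : ℝ) * ((2 ^ j)⁻¹ * ξ 0) := by
  rw [dualEquiv, matrixEquiv_apply, toEuclideanLin_apply_one]
  simp [dualMat]
  ring

theorem shearEquiv_apply_zero (x : Plane) :
    shearEquiv j k x 0 = 2 ^ j * x 0 + k * (2 : ℝ) ^ ((j : ℝ) / 2) * x 1 := by
  rw [shearEquiv, matrixEquiv_apply, toEuclideanLin_apply_zero]
  simp [shearMat, scaleMat, Matrix.mul_apply, Fin.sum_univ_two]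

theorem shearEquiv_apply_one (x : Plane) :
    shearEquiv j k x 1 = (2 : ℝ) ^ ((j : ℝ) / 2) * x 1 := by
  rw [shearEquiv, matrixEquiv_apply, toEuclideanLin_apply_one]
  simp [shearMat, scaleMat, Matrix.mul_apply, Fin.sum_univ_two]

theorem inner_plane (x y : Plane) : inner ℝ x y = x 0 * y 0 + x 1 * y 1 := by
  simp [PiLp.inner_apply, Fin.sum_univ_two, mul_comm]

theorem inner_shearEquiv_dualEquiv (x ξ : Plane) :
    inner ℝ (shearEquiv j k x) (dualEquiv j k ξ) = inner ℝ x ξ := by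
  have h : (0 : ℝ) < (2 : ℝ) ^ ((j : ℝ) / 2) := by positivity
  rw [inner_plane, inner_plane, shearEquiv_apply_zero, shearEquiv_apply_one, dualEquiv_apply_zero,
    dualEquiv_apply_one]
  push_cast
  field_simp
  ring

theorem quasiMeasurePreserving_dualEquiv :
    Measure.QuasiMeasurePreserving (dualEquiv j k) (volume : Measure Plane) volume :=
  ⟨(dualEquiv j k).continuous.measurable, by
    rw [map_dualEquiv]
    exact Measure.smul_absolutelyContinuous⟩

end Geometry

/-! ### Existence and uniqueness of the shearlet. -/

section Existence

theorem lintegral_enorm_sq (g : L2Plane) : ∫⁻ ξ, ‖g ξ‖ₑ ^ 2 = ‖g‖ₑ ^ 2 := by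
  rw [Lp.enorm_def, eLpNorm_eq_lintegral_rpow_enorm_toReal two_ne_zero ENNReal.ofNat_ne_top,
    ← ENNReal.rpow_natCast, ← ENNReal.rpow_mul]
  simp

theorem quasiMeasurePreserving_smul {r : ℝ} (hr : r ≠ 0) :
    Measure.QuasiMeasurePreserving (fun ξ : Plane => r • ξ) volume volume :=
  ⟨by fun_prop, by
    rw [Measure.map_addHaar_smul _ hr]
    exact Measure.smul_absolutelyContinuous⟩

variable {N₁ l₁ N₂ l₂ : ℕ} {a₁ a₂ : ℤ →₀ ℝ}

/-- Dilation by $\pi$ reconciles the normalizations, since $(2\pi)^{-1}\cdot2\cdot\pi=1$; dilations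
preserve null sets. -/
theorem isShearlet_iff (ψ : L2Plane) : IsShearlet a₁ a₂ ψ ↔
    (𝓕 ψ : L2Plane) =ᵐ[volume] fun ξ => shearletHat a₁ a₂ (ξ 0) (ξ 1) := by
  have hπ := Real.pi_ne_zero
  constructor
  · intro h
    filter_upwards [(quasiMeasurePreserving_smul hπ).ae h] with ξ hξ
    have e : (2 * Real.pi)⁻¹ • (2 : ℝ) • Real.pi • ξ = ξ := by
      rw [smul_smul, smul_smul]
      convert one_smul ℝ ξ using 2
      field_simp
    rw [hat, e] at hξ
    rw [hξ]
    simp [shearletHat]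
  · intro h
    filter_upwards [(quasiMeasurePreserving_smul (inv_ne_zero hπ)).ae h] with ξ hξ
    have e : (2 * Real.pi)⁻¹ • (2 : ℝ) • ξ = Real.pi⁻¹ • ξ := by
      rw [smul_smul]
      congr 1
      field_simp
    rw [hat, e, hξ]
    simp [shearletHat, hπ]

theorem measurable_shearletHat_plane (h₂ : IsTypeIMask N₂ l₂ a₂) :
    Measurable fun ξ : Plane => shearletHat a₁ a₂ (ξ 0) (ξ 1) :=
  (measurable_shearletHat h₂).comp (f := fun ξ : Plane => (ξ 0, ξ 1)) (by fun_prop)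

theorem integrable_decay {s : ℝ} (hs : 1 < s) : Integrable (decay s) := by
  have := integrable_one_add_norm (E := ℝ) (μ := volume) (r := s) (by simpa using hs)
  simpa [decay, Real.norm_eq_abs] using! this

theorem memLp_shearletHat (h₁ : IsTypeIMask N₁ l₁ a₁) (h₂ : IsTypeIMask N₂ l₂ a₂)
    (hN₁ : 3 ≤ N₁) (hl₂ : l₂ < N₂) (hN₂ : 3 ≤ N₂) :
    MemLp (fun ξ : Plane => shearletHat a₁ a₂ (ξ 0) (ξ 1)) 2 volume := by
  obtain ⟨C, hC, hG⟩ := exists_norm_shearletHat_le h₁ h₂ hN₁ hl₂ hN₂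
  have hm := (measurable_shearletHat_plane (a₁ := a₁) h₂).aestronglyMeasurable (μ := volume)
  rw [memLp_two_iff_integrable_sq_norm hm]
  have h1 : Integrable (fun x : Fin 2 → ℝ => ∏ i, decay (5 / 4) (x i)) :=
    Integrable.fintype_prod (f := fun _ : Fin 2 => decay (5 / 4)) (μ := fun _ => volume)
      fun _ => integrable_decay (by norm_num)
  have h2 := ((PiLp.volume_preserving_ofLp (Fin 2)).integrable_comp_of_integrable h1).const_mul
    (C ^ 2)
  refine h2.mono' (hm.norm.pow 2) (Eventually.of_forall fun ξ => ?_)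
  rw [Real.norm_of_nonneg (sq_nonneg _)]
  simp only [Function.comp_apply, Fin.prod_univ_two]
  have hd0 : ∀ z, 0 ≤ decay (5 / 4) z := fun z => (decay_pos _ z).le
  have hd1 : ∀ z, decay (5 / 4) z ≤ 1 := decay_le_one (by norm_num)
  have hle : ‖shearletHat a₁ a₂ (ξ 0) (ξ 1)‖ ≤ C * (decay (5 / 4) (ξ 0) * decay (5 / 4) (ξ 1)) := by
    refine (hG _ _).trans ?_
    rw [mul_assoc (min _ _)]
    refine mul_le_mul_of_nonneg_left ?_ hC.le
    exact mul_le_of_le_one_left (mul_nonneg (hd0 _) (hd0 _)) (min_le_left _ _)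
  have hP0 := mul_nonneg (hd0 (ξ 0)) (hd0 (ξ 1))
  have hP1 : decay (5 / 4) (ξ 0) * decay (5 / 4) (ξ 1) ≤ 1 := mul_le_one₀ (hd1 _) (hd0 _) (hd1 _)
  calc _ ≤ (C * (decay (5 / 4) (ξ 0) * decay (5 / 4) (ξ 1))) ^ 2 := by gcongr
    _ = C ^ 2 * (decay (5 / 4) (ξ 0) * decay (5 / 4) (ξ 1)) ^ 2 := mul_pow _ _ _
    _ ≤ _ := by
      gcongr
      exact pow_le_of_le_one hP0 hP1 two_ne_zero

theorem existsUnique_isShearlet (h₁ : IsTypeIMask N₁ l₁ a₁) (h₂ : IsTypeIMask N₂ l₂ a₂)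
    (hN₁ : 3 ≤ N₁) (hl₂ : l₂ < N₂) (hN₂ : 3 ≤ N₂) : ∃! ψ : L2Plane, IsShearlet a₁ a₂ ψ := by
  have hG := memLp_shearletHat h₁ h₂ hN₁ hl₂ hN₂
  refine ⟨𝓕⁻ (hG.toLp _), ?_, fun ψ hψ => ?_⟩
  · refine (isShearlet_iff _).2 ?_
    rw [FourierTransform.fourier_fourierInv_eq]
    exact hG.coeFn_toLp
  · replace hψ := (isShearlet_iff _).1 hψ
    have : (𝓕 ψ : L2Plane) = hG.toLp _ := Lp.ext (hψ.trans hG.coeFn_toLp.symm)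
    rw [← this, FourierTransform.fourierInv_fourier_eq]

end Existence

/-! ### Shearlet coefficients as integrals against integer characters. -/

section Coefficients

variable (c₁ c₂ : ℝ) (j : ℕ) (k : ℤ)

/-- The linear map from the coordinates in which the translation lattice is `ℤ²` to
frequencies. -/
def latticeMap (y : Fin 2 → ℝ) : Plane :=
  (dualEquiv j k).symm (WithLp.toLp 2 (Matrix.toLin' (Matrix.diagonal ![c₁⁻¹, c₂⁻¹]) y))

theorem dualEquiv_latticeMap (y : Fin 2 → ℝ) :
    dualEquiv j k (latticeMap c₁ c₂ j k y) = !₂[y 0 / c₁, y 1 / c₂] := by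
  rw [latticeMap, ContinuousLinearEquiv.apply_symm_apply]
  ext i
  fin_cases i <;> simp [Matrix.mulVec_diagonal, div_eq_inv_mul]

theorem measurable_latticeMap : Measurable (latticeMap c₁ c₂ j k) := by
  have h : Continuous fun y : Fin 2 → ℝ => Matrix.toLin' (Matrix.diagonal ![c₁⁻¹, c₂⁻¹]) y :=
    LinearMap.continuous_of_finiteDimensional _
  exact (dualEquiv j k).symm.continuous.measurable.comp
    ((PiLp.volume_preserving_toLp (Fin 2)).measurable.comp h.measurable)

variable {c₁ c₂}

theorem map_latticeMap (h1 : 0 < c₁) (h2 : 0 < c₂) : Measure.map (latticeMap c₁ c₂ j k) volume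
    = ENNReal.ofReal (c₁ * c₂ / scaleDet j) • (volume : Measure Plane) := by
  have hd := scaleDet_pos j
  have hdet : (Matrix.diagonal ![c₁⁻¹, c₂⁻¹] : Matrix (Fin 2) (Fin 2) ℝ).det = (c₁ * c₂)⁻¹ := by
    simp [Matrix.det_diagonal, mul_comm]
  have hdiag := Real.map_matrix_volume_pi_eq_smul_volume_pi
    (M := Matrix.diagonal ![c₁⁻¹, c₂⁻¹]) (by rw [hdet]; positivity)
  rw [hdet, inv_inv, abs_of_pos (by positivity)] at hdiag
  have hsymm : Measure.map (dualEquiv j k).symm volume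
      = ENNReal.ofReal (scaleDet j)⁻¹ • (volume : Measure Plane) := by
    have h := congrArg (Measure.map (dualEquiv j k).symm) (map_dualEquiv j k)
    rw [Measure.map_map (dualEquiv j k).symm.continuous.measurable
      (dualEquiv j k).continuous.measurable, Measure.map_smul] at h
    have e : (dualEquiv j k).symm ∘ (dualEquiv j k) = id := by
      ext x : 1
      simp
    rw [e, Measure.map_id] at h
    have h3 := congrArg (fun μ : Measure Plane => ENNReal.ofReal (scaleDet j)⁻¹ • μ) h
    simp only [smul_smul] at h3
    rw [← ENNReal.ofReal_mul (by positivity), inv_mul_cancel₀ hd.ne', ENNReal.ofReal_one,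
      one_smul] at h3
    exact h3.symm
  have hlin : Continuous fun y : Fin 2 → ℝ => Matrix.toLin' (Matrix.diagonal ![c₁⁻¹, c₂⁻¹]) y :=
    LinearMap.continuous_of_finiteDimensional _
  have hto := PiLp.volume_preserving_toLp (Fin 2)
  have hcomp : latticeMap c₁ c₂ j k = (dualEquiv j k).symm ∘ (@WithLp.toLp 2 (Fin 2 → ℝ)) ∘
      fun y => Matrix.toLin' (Matrix.diagonal ![c₁⁻¹, c₂⁻¹]) y := rfl
  rw [hcomp, ← Measure.map_map (dualEquiv j k).symm.continuous.measurable
    (hto.measurable.comp hlin.measurable), ← Measure.map_map hto.measurable hlin.measurable, hdiag,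
    Measure.map_smul, hto.map_eq, Measure.map_smul, hsymm, smul_smul,
    ← ENNReal.ofReal_mul (by positivity), div_eq_mul_inv]

theorem lintegral_latticeMap (h1 : 0 < c₁) (h2 : 0 < c₂) {g : Plane → ENNReal} (hg : Measurable g) :
    ∫⁻ y, g (latticeMap c₁ c₂ j k y) = ENNReal.ofReal (c₁ * c₂ / scaleDet j) * ∫⁻ ξ, g ξ := by
  rw [← lintegral_map hg (measurable_latticeMap c₁ c₂ j k), map_latticeMap j k h1 h2,
    lintegral_smul_measure, smul_eq_mul]

theorem integral_latticeMap (h1 : 0 < c₁) (h2 : 0 < c₂) {g : Plane → ℂ} (hg : Measurable g) :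
    ∫ ξ, g ξ = ((scaleDet j / (c₁ * c₂) : ℝ) : ℂ) * ∫ y, g (latticeMap c₁ c₂ j k y) := by
  have hd := scaleDet_pos j
  rw [← integral_map (measurable_latticeMap c₁ c₂ j k).aemeasurable hg.aestronglyMeasurable,
    map_latticeMap j k h1 h2, integral_smul_measure, ENNReal.toReal_ofReal (by positivity),
    Complex.real_smul, ← mul_assoc, ← Complex.ofReal_mul]
  have : scaleDet j / (c₁ * c₂) * (c₁ * c₂ / scaleDet j) = 1 := by field_simp
  rw [this, Complex.ofReal_one, one_mul]

theorem sq_scaleFactor : ((2 : ℝ) ^ (3 * (j : ℝ) / 4)) ^ 2 = scaleDet j := by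
  rw [scaleDet, ← Real.rpow_natCast 2 j, ← Real.rpow_add two_pos, ← Real.rpow_mul_natCast two_pos.le]
  congr 1
  push_cast
  ring

variable {G : ℝ → ℝ → ℂ}

/-- Plancherel and the affine rule give an integral over frequencies; in the coordinates of
`latticeMap` the modulation becomes an integer character and the dilated $G$ loses its dependence on
$j$ and $k$. -/
theorem inner_shearletFun (h1 : 0 < c₁) (h2 : 0 < c₂)
    (hGm : Measurable fun p : ℝ × ℝ => G p.1 p.2) (f ψ : L2Plane)
    (hψ : (𝓕 ψ : L2Plane) =ᵐ[volume] fun ξ => G (ξ 0) (ξ 1)) (m : Fin 2 → ℤ) :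
    inner ℂ f ((memLp_shearletFun ψ c₁ c₂ j k (m 0, m 1)).toLp _)
      = (((2 : ℝ) ^ (3 * (j : ℝ) / 4) / (c₁ * c₂) : ℝ) : ℂ)
        * ∫ y, intChar (-m) y * ((starRingEnd ℂ) ((𝓕 f : L2Plane) (latticeMap c₁ c₂ j k y))
          * G (y 0 / c₁) (y 1 / c₂)) := by
  have hd := scaleDet_pos j
  set s : ℝ := (2 : ℝ) ^ (3 * (j : ℝ) / 4) with hs
  set v : Plane := !₂[c₁ * (m 0 : ℝ), c₂ * (m 1 : ℝ)] with hv
  have hF : Measurable (𝓕 f : L2Plane) := (Lp.stronglyMeasurable (𝓕 f : L2Plane)).measurable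
  have hB : Measurable (dualEquiv j k) := (dualEquiv j k).continuous.measurable
  have hGB : Measurable fun ξ : Plane => G (dualEquiv j k ξ 0) (dualEquiv j k ξ 1) :=
    hGm.comp (f := fun ξ : Plane => (dualEquiv j k ξ 0, dualEquiv j k ξ 1)) (by fun_prop)
  have hfour := fourier_comp_affine (A := shearEquiv j k) (B := dualEquiv j k)
    (inv_nonneg.2 hd.le) (map_shearEquiv j k) ENNReal.ofReal_ne_top (map_dualEquiv j k)
    (inner_shearEquiv_dualEquiv j k) v (s : ℂ) ψ
    (memLp_shearletFun ψ c₁ c₂ j k (m 0, m 1))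
  rw [← Lp.inner_fourier_eq, L2.inner_def]
  have h3 : ∫ ξ, inner ℂ ((𝓕 f : L2Plane) ξ)
        ((𝓕 ((memLp_shearletFun ψ c₁ c₂ j k (m 0, m 1)).toLp _) : L2Plane) ξ)
      = ∫ ξ, (s : ℂ) * ((scaleDet j)⁻¹ : ℝ) * (Complex.exp (-2 * Real.pi * Complex.I
          * (inner ℝ v (dualEquiv j k ξ) : ℝ))
        * ((starRingEnd ℂ) ((𝓕 f : L2Plane) ξ)
          * G (dualEquiv j k ξ 0) (dualEquiv j k ξ 1))) := by
    refine integral_congr_ae ?_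
    filter_upwards [hfour, (quasiMeasurePreserving_dualEquiv j k).ae hψ] with ξ h4 h5
    refine (congrArg (fun z => inner ℂ ((𝓕 f : L2Plane) ξ) z) h4).trans ?_
    simp only [RCLike.inner_apply]
    rw [h5]
    ring
  rw [h3, integral_const_mul, integral_latticeMap j k h1 h2, ← mul_assoc]
  -- The Jacobian of the affine rule cancels the determinant in the change of variables and leaves
  -- $2^{3j/4}/(c_1c_2)$.
  · congr 1
    · push_cast
      have : (scaleDet j : ℂ) ≠ 0 := by exact_mod_cast hd.ne'
      field_simp
    · refine integral_congr_ae (Eventually.of_forall fun y => ?_)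
      simp only [dualEquiv_latticeMap]
      congr 1
      rw [intChar_eq, inner_plane]
      congr 1
      simp only [hv, Fin.sum_univ_two]
      have := h1.ne'
      have := h2.ne'
      have e : c₁ * (m 0 : ℝ) * (y 0 / c₁) + c₂ * (m 1 : ℝ) * (y 1 / c₂)
          = m 0 * y 0 + m 1 * y 1 := by field_simp
      simp [e]
      ring
  · have : Measurable fun ξ : Plane => Complex.exp (-2 * Real.pi * Complex.I
          * (inner ℝ v (dualEquiv j k ξ) : ℝ)) := Continuous.measurable (by fun_prop)
    exact this.mul ((Complex.continuous_conj.measurable.comp hF).mul hGB)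

end Coefficients

/-! ### Estimates for one scale and one shear. -/

section SingleScale

variable {c₁ c₂ K K' : ℝ} (j : ℕ) (k : ℤ) {G : ℝ → ℝ → ℂ}

theorem tsum_enorm_sq_inner_shearletFun (h1 : 0 < c₁) (h2 : 0 < c₂)
    (hGm : Measurable fun p : ℝ × ℝ => G p.1 p.2) (f ψ : L2Plane)
    (hψ : (𝓕 ψ : L2Plane) =ᵐ[volume] fun ξ => G (ξ 0) (ξ 1)) :
    ∑' m : ℤ × ℤ, ‖inner ℂ f ((memLp_shearletFun ψ c₁ c₂ j k m).toLp _)‖ₑ ^ 2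
      = ENNReal.ofReal (scaleDet j / (c₁ * c₂) ^ 2) * ∑' m : Fin 2 → ℤ,
        ‖∫ y, intChar (-m) y * ((starRingEnd ℂ) ((𝓕 f : L2Plane) (latticeMap c₁ c₂ j k y))
          * G (y 0 / c₁) (y 1 / c₂))‖ₑ ^ 2 := by
  rw [← (finTwoArrowEquiv ℤ).tsum_eq, ← ENNReal.tsum_mul_left]
  refine tsum_congr fun m => ?_
  change ‖inner ℂ f ((memLp_shearletFun ψ c₁ c₂ j k (m 0, m 1)).toLp _)‖ₑ ^ 2 = _
  rw [inner_shearletFun j k h1 h2 hGm f ψ hψ m, enorm_mul, mul_pow]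
  congr 1
  rw [← ofReal_norm, Complex.norm_real, Real.norm_of_nonneg (by positivity),
    ← ENNReal.ofReal_pow (by positivity), div_pow, sq_scaleFactor]

theorem measurable_comp_dualEquiv {β : Type*} [MeasurableSpace β] {g : ℝ × ℝ → β}
    (hg : Measurable g) : Measurable fun ξ : Plane => g (dualEquiv j k ξ 0, dualEquiv j k ξ 1) :=
  hg.comp (f := fun ξ : Plane => (dualEquiv j k ξ 0, dualEquiv j k ξ 1)) (by fun_prop)

/-- The square of $2^{3j/4}$ is $\det A_{2^j}$, which the Jacobian of `latticeMap` cancels. The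
constant is therefore the same for all scales and shears, as needed for summing over them. -/
theorem ofReal_mul_lintegral_latticeMap (h1 : 0 < c₁) (h2 : 0 < c₂) (f : L2Plane)
    {g : ℝ × ℝ → ENNReal} (hg : Measurable g) :
    ENNReal.ofReal (scaleDet j / (c₁ * c₂) ^ 2)
        * ∫⁻ y, ‖(starRingEnd ℂ) ((𝓕 f : L2Plane) (latticeMap c₁ c₂ j k y))‖ₑ ^ 2
          * g (y 0 / c₁, y 1 / c₂)
      = ENNReal.ofReal (1 / (c₁ * c₂)) * ∫⁻ ξ, ‖(𝓕 f : L2Plane) ξ‖ₑ ^ 2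
          * g (dualEquiv j k ξ 0, dualEquiv j k ξ 1) := by
  have hd := scaleDet_pos j
  have hF : Measurable (𝓕 f : L2Plane) := (Lp.stronglyMeasurable (𝓕 f : L2Plane)).measurable
  have h := lintegral_latticeMap j k h1 h2 (g := fun ξ => ‖(𝓕 f : L2Plane) ξ‖ₑ ^ 2
    * g (dualEquiv j k ξ 0, dualEquiv j k ξ 1))
    ((hF.enorm.pow_const 2).mul (measurable_comp_dualEquiv j k hg))
  simp only [dualEquiv_latticeMap] at h
  have e : ENNReal.ofReal (1 / (c₁ * c₂))
      = ENNReal.ofReal (scaleDet j / (c₁ * c₂) ^ 2) * ENNReal.ofReal (c₁ * c₂ / scaleDet j) := by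
    rw [← ENNReal.ofReal_mul (by positivity)]
    congr 1
    field_simp
  rw [e, mul_assoc, ← h]
  simp

theorem lintegral_latticeMap_ne_top (h1 : 0 < c₁) (h2 : 0 < c₂) (f : L2Plane) :
    ∫⁻ y, ‖(starRingEnd ℂ) ((𝓕 f : L2Plane) (latticeMap c₁ c₂ j k y))‖ₑ ^ 2 ≠ ⊤ := by
  have hF : Measurable (𝓕 f : L2Plane) := (Lp.stronglyMeasurable (𝓕 f : L2Plane)).measurable
  have e : ∀ z : ℂ, ‖(starRingEnd ℂ) z‖ₑ = ‖z‖ₑ := fun z => by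
    rw [← ofReal_norm, ← ofReal_norm, RCLike.norm_conj]
  simp only [e]
  rw [lintegral_latticeMap j k h1 h2 (g := fun ξ => ‖(𝓕 f : L2Plane) ξ‖ₑ ^ 2)
    (hF.enorm.pow_const 2), lintegral_enorm_sq]
  exact ENNReal.mul_ne_top ENNReal.ofReal_ne_top (ENNReal.pow_ne_top enorm_ne_top)

theorem tsum_inner_shearletFun_le (h1 : 0 < c₁) (h2 : 0 < c₂)
    (hGm : Measurable fun p : ℝ × ℝ => G p.1 p.2)
    (f ψ : L2Plane) (hψ : (𝓕 ψ : L2Plane) =ᵐ[volume] fun ξ => G (ξ 0) (ξ 1))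
    (hK : ∀ x y, ‖G x y‖ₑ * ∑' n : Fin 2 → ℤ, ‖G (x + n 0 / c₁) (y + n 1 / c₂)‖ₑ
      ≤ ENNReal.ofReal K * ENNReal.ofReal (envelope x y)) :
    ∑' m : ℤ × ℤ, ‖inner ℂ f ((memLp_shearletFun ψ c₁ c₂ j k m).toLp _)‖ₑ ^ 2
      ≤ ENNReal.ofReal (1 / (c₁ * c₂)) * (2 * ENNReal.ofReal K)
        * ∫⁻ ξ, ‖(𝓕 f : L2Plane) ξ‖ₑ ^ 2
          * ENNReal.ofReal (envelope (dualEquiv j k ξ 0) (dualEquiv j k ξ 1)) := by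
  have hd := scaleDet_pos j
  have hF : Measurable (𝓕 f : L2Plane) := (Lp.stronglyMeasurable (𝓕 f : L2Plane)).measurable
  have hfm : Measurable fun y => (starRingEnd ℂ) ((𝓕 f : L2Plane) (latticeMap c₁ c₂ j k y)) :=
    Complex.continuous_conj.measurable.comp (hF.comp (measurable_latticeMap c₁ c₂ j k))
  have hΨm : Measurable fun y : Fin 2 → ℝ => G (y 0 / c₁) (y 1 / c₂) :=
    hGm.comp (f := fun y : Fin 2 → ℝ => (y 0 / c₁, y 1 / c₂)) (by fun_prop)
  have hle : ∀ y : Fin 2 → ℝ, ‖G (y 0 / c₁) (y 1 / c₂)‖ₑ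
        * ∑' n : Fin 2 → ℤ, ‖G ((y + intVec n) 0 / c₁) ((y + intVec n) 1 / c₂)‖ₑ
      ≤ ENNReal.ofReal K * ENNReal.ofReal (envelope (y 0 / c₁) (y 1 / c₂)) := by
    intro y
    have := hK (y 0 / c₁) (y 1 / c₂)
    simpa only [Pi.add_apply, intVec, add_div] using this
  have hbd : ∀ y : Fin 2 → ℝ, ‖G (y 0 / c₁) (y 1 / c₂)‖ₑ
        * ∑' n : Fin 2 → ℤ, ‖G ((y + intVec n) 0 / c₁) ((y + intVec n) 1 / c₂)‖ₑ
      ≤ ENNReal.ofReal K := fun y => (hle y).trans <| mul_le_of_le_one_right' <| by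
    simpa using envelope_le_one (y 0 / c₁) (y 1 / c₂)
  have hfin := lintegral_latticeMap_ne_top j k h1 h2 f
  have henv : Measurable fun p : ℝ × ℝ => ENNReal.ofReal (envelope p.1 p.2) :=
    measurable_envelope.ennreal_ofReal
  have hint := ofReal_mul_lintegral_latticeMap j k h1 h2 f henv
  have hmain := tsum_enorm_sq_intChar_le hfm hΨm hfin ENNReal.ofReal_ne_top hbd
  rw [tsum_enorm_sq_inner_shearletFun j k h1 h2 hGm f ψ hψ]
  calc _ ≤ ENNReal.ofReal (scaleDet j / (c₁ * c₂) ^ 2) * (2 * ∫⁻ y,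
        ‖(starRingEnd ℂ) ((𝓕 f : L2Plane) (latticeMap c₁ c₂ j k y))‖ₑ ^ 2
          * (ENNReal.ofReal K * ENNReal.ofReal (envelope (y 0 / c₁) (y 1 / c₂)))) := by
        refine mul_le_mul_right (hmain.trans (mul_le_mul_right (lintegral_mono fun y => ?_) _)) _
        exact mul_le_mul_right (hle y) _
    _ = ENNReal.ofReal (scaleDet j / (c₁ * c₂) ^ 2) * (∫⁻ y,
        ‖(starRingEnd ℂ) ((𝓕 f : L2Plane) (latticeMap c₁ c₂ j k y))‖ₑ ^ 2
          * ENNReal.ofReal (envelope (y 0 / c₁) (y 1 / c₂))) * (2 * ENNReal.ofReal K) := by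
        simp_rw [mul_left_comm _ (ENNReal.ofReal K)]
        rw [lintegral_const_mul' _ _ ENNReal.ofReal_ne_top]
        ring
    _ = _ := by
        rw [hint]
        ring

theorem lintegral_le_tsum_inner_shearletFun (h1 : 0 < c₁) (h2 : 0 < c₂)
    (hGm : Measurable fun p : ℝ × ℝ => G p.1 p.2)
    (f ψ : L2Plane) (hψ : (𝓕 ψ : L2Plane) =ᵐ[volume] fun ξ => G (ξ 0) (ξ 1))
    (hK : ∀ x y, ‖G x y‖ₑ * ∑' n : Fin 2 → ℤ, ‖G (x + n 0 / c₁) (y + n 1 / c₂)‖ₑ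
      ≤ ENNReal.ofReal K * ENNReal.ofReal (envelope x y))
    (hK' : ∀ x y, ‖G x y‖ₑ * ∑' n : Fin 2 → ℤ, (if n = 0 then 0 else 1)
        * ‖G (x + n 0 / c₁) (y + n 1 / c₂)‖ₑ
      ≤ ENNReal.ofReal K' * ENNReal.ofReal (envelope x y)) :
    ENNReal.ofReal (1 / (c₁ * c₂)) * ∫⁻ ξ, ‖(𝓕 f : L2Plane) ξ‖ₑ ^ 2
          * ‖G (dualEquiv j k ξ 0) (dualEquiv j k ξ 1)‖ₑ ^ 2
      ≤ ∑' m : ℤ × ℤ, ‖inner ℂ f ((memLp_shearletFun ψ c₁ c₂ j k m).toLp _)‖ₑ ^ 2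
        + ENNReal.ofReal (1 / (c₁ * c₂)) * (2 * ENNReal.ofReal K')
          * ∫⁻ ξ, ‖(𝓕 f : L2Plane) ξ‖ₑ ^ 2
            * ENNReal.ofReal (envelope (dualEquiv j k ξ 0) (dualEquiv j k ξ 1)) := by
  have hd := scaleDet_pos j
  have hF : Measurable (𝓕 f : L2Plane) := (Lp.stronglyMeasurable (𝓕 f : L2Plane)).measurable
  have hfm : Measurable fun y => (starRingEnd ℂ) ((𝓕 f : L2Plane) (latticeMap c₁ c₂ j k y)) :=
    Complex.continuous_conj.measurable.comp (hF.comp (measurable_latticeMap c₁ c₂ j k))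
  have hΨm : Measurable fun y : Fin 2 → ℝ => G (y 0 / c₁) (y 1 / c₂) :=
    hGm.comp (f := fun y : Fin 2 → ℝ => (y 0 / c₁, y 1 / c₂)) (by fun_prop)
  have hle : ∀ y : Fin 2 → ℝ, ‖G (y 0 / c₁) (y 1 / c₂)‖ₑ
        * ∑' n : Fin 2 → ℤ, ‖G ((y + intVec n) 0 / c₁) ((y + intVec n) 1 / c₂)‖ₑ
      ≤ ENNReal.ofReal K * ENNReal.ofReal (envelope (y 0 / c₁) (y 1 / c₂)) := by
    intro y
    have := hK (y 0 / c₁) (y 1 / c₂)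
    simpa only [Pi.add_apply, intVec, add_div] using this
  have hbd : ∀ y : Fin 2 → ℝ, ‖G (y 0 / c₁) (y 1 / c₂)‖ₑ
        * ∑' n : Fin 2 → ℤ, ‖G ((y + intVec n) 0 / c₁) ((y + intVec n) 1 / c₂)‖ₑ
      ≤ ENNReal.ofReal K := fun y => (hle y).trans <| mul_le_of_le_one_right' <| by
    simpa using envelope_le_one (y 0 / c₁) (y 1 / c₂)
  have hfin := lintegral_latticeMap_ne_top j k h1 h2 f
  have henv : Measurable fun p : ℝ × ℝ => ENNReal.ofReal (envelope p.1 p.2) :=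
    measurable_envelope.ennreal_ofReal
  have hint := ofReal_mul_lintegral_latticeMap j k h1 h2 f henv
  have hmain := lintegral_le_tsum_enorm_sq_intChar hfm hΨm hfin ENNReal.ofReal_ne_top hbd
  have hle' : ∀ y : Fin 2 → ℝ, ‖G (y 0 / c₁) (y 1 / c₂)‖ₑ
        * ∑' n : Fin 2 → ℤ, (if n = 0 then 0 else 1)
          * ‖G ((y + intVec n) 0 / c₁) ((y + intVec n) 1 / c₂)‖ₑ
      ≤ ENNReal.ofReal K' * ENNReal.ofReal (envelope (y 0 / c₁) (y 1 / c₂)) := by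
    intro y
    have := hK' (y 0 / c₁) (y 1 / c₂)
    simpa only [Pi.add_apply, intVec, add_div] using this
  have hsq : Measurable fun p : ℝ × ℝ => ‖G p.1 p.2‖ₑ ^ 2 := hGm.enorm.pow_const 2
  rw [tsum_enorm_sq_inner_shearletFun j k h1 h2 hGm f ψ hψ,
    ← ofReal_mul_lintegral_latticeMap j k h1 h2 f hsq]
  set S := ∑' m : Fin 2 → ℤ,
    ‖∫ y, intChar (-m) y * ((starRingEnd ℂ) ((𝓕 f : L2Plane) (latticeMap c₁ c₂ j k y))
      * G (y 0 / c₁) (y 1 / c₂))‖ₑ ^ 2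
  set D := ENNReal.ofReal (scaleDet j / (c₁ * c₂) ^ 2)
  calc _ ≤ D * (S + 2 * ∫⁻ y, ‖(starRingEnd ℂ) ((𝓕 f : L2Plane) (latticeMap c₁ c₂ j k y))‖ₑ ^ 2
          * (ENNReal.ofReal K' * ENNReal.ofReal (envelope (y 0 / c₁) (y 1 / c₂)))) := by
        refine mul_le_mul_right (hmain.trans (add_le_add_right (mul_le_mul_right
          (lintegral_mono fun y => ?_) _) _)) _
        exact mul_le_mul_right (hle' y) _
    _ = D * S + D * (∫⁻ y,
        ‖(starRingEnd ℂ) ((𝓕 f : L2Plane) (latticeMap c₁ c₂ j k y))‖ₑ ^ 2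
          * ENNReal.ofReal (envelope (y 0 / c₁) (y 1 / c₂))) * (2 * ENNReal.ofReal K') := by
        simp_rw [mul_left_comm _ (ENNReal.ofReal K')]
        rw [lintegral_const_mul' _ _ ENNReal.ofReal_ne_top, mul_add]
        ring
    _ = _ := by
        rw [hint]
        ring

end SingleScale

/-! ### Summation over scales and shears. -/

section Frame

/-- The admissible pairs of a scale and a shear. -/
abbrev ScaleShear : Type := {p : ℕ × ℤ // |p.2| ≤ ⌈(2 : ℝ) ^ ((p.1 : ℝ) / 2)⌉}

/-- The index set of the system as a product. -/
def shearIndexEquiv : ScaleShear × (ℤ × ℤ) ≃ ShearIndex where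
  toFun q := ⟨(q.1.1.1, q.1.1.2, q.2), q.1.2⟩
  invFun i := (⟨(i.1.1, i.1.2.1), i.2⟩, i.1.2.2)
  left_inv _ := rfl
  right_inv _ := rfl

theorem tsum_shearIndex (ψ f : L2Plane) (c₁ c₂ : ℝ) :
    ∑' i, ‖inner ℂ f (shearletSystem ψ c₁ c₂ i)‖ₑ ^ 2
      = ∑' p : ScaleShear, ∑' m : ℤ × ℤ,
        ‖inner ℂ f ((memLp_shearletFun ψ c₁ c₂ p.1.1 p.1.2 m).toLp _)‖ₑ ^ 2 := by
  rw [← shearIndexEquiv.tsum_eq]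
  exact ENNReal.tsum_prod (f := fun (p : ScaleShear) (m : ℤ × ℤ) =>
    ‖inner ℂ f ((memLp_shearletFun ψ c₁ c₂ p.1.1 p.1.2 m).toLp _)‖ₑ ^ 2)

/-- The envelope is summable over all integer shears, so the restriction on $k$ can be dropped here;
it matters only for the lower bound. -/
theorem exists_tsum_envelope_dualEquiv_le :
    ∃ K : ℝ, 0 < K ∧ ∀ ξ : Plane, ∑' p : ScaleShear,
      ENNReal.ofReal (envelope (dualEquiv p.1.1 p.1.2 ξ 0) (dualEquiv p.1.1 p.1.2 ξ 1))
        ≤ ENNReal.ofReal K := by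
  obtain ⟨K, hK, h⟩ := exists_tsum_envelope_le
  refine ⟨K, hK, fun ξ => ?_⟩
  refine (ENNReal.tsum_comp_le_tsum_of_injective Subtype.val_injective (fun p : ℕ × ℤ =>
    ENNReal.ofReal (envelope (dualEquiv p.1 p.2 ξ 0) (dualEquiv p.1 p.2 ξ 1)))).trans ?_
  rw [ENNReal.tsum_prod (f := fun j k =>
    ENNReal.ofReal (envelope (dualEquiv j k ξ 0) (dualEquiv j k ξ 1)))]
  refine le_trans (le_of_eq ?_) (h (ξ 0) fun j => ((2 : ℝ) ^ ((j : ℝ) / 2))⁻¹ * ξ 1)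
  refine tsum_congr fun j => ?_
  rw [← (Equiv.neg ℤ).tsum_eq]
  simp [dualEquiv_apply_zero, dualEquiv_apply_one]

variable {N₁ l₁ N₂ l₂ : ℕ} {a₁ a₂ : ℤ →₀ ℝ}

theorem exists_le_tsum_shearletHat (h₁ : IsTypeIMask N₁ l₁ a₁) (h₂ : IsTypeIMask N₂ l₂ a₂) {α : ℝ}
    (hα : 0 < α) (hα2 : α ≤ Real.pi) :
    ∃ A : ℝ, 0 < A ∧ ∀ ξ : Plane, (2 * Real.pi) • ξ ∈ horizontalCones α →
      ENNReal.ofReal A ≤ ∑' p : ScaleShear,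
        ‖shearletHat a₁ a₂ (dualEquiv p.1.1 p.1.2 ξ 0) (dualEquiv p.1.1 p.1.2 ξ 1)‖ₑ ^ 2 := by
  have hπ := Real.pi_pos
  have hs : 0 < Real.sin (α / 4) := Real.sin_pos_of_pos_of_lt_pi (by positivity) (by linarith)
  set A := Real.sin (α / 4) ^ N₁ * ((2 / Real.pi) ^ N₂ * (2 / Real.pi) ^ N₂) with hA
  refine ⟨A ^ 2, by positivity, fun ξ hξ => ?_⟩
  have hcone : α ≤ 2 * Real.pi * |ξ 0| ∧ |ξ 1| ≤ |ξ 0| := by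
    have h2π : (0 : ℝ) < 2 * Real.pi := by positivity
    have key : ∀ z : ℝ, α ≤ |z| → z = 2 * Real.pi * ξ 0 → |2 * Real.pi * ξ 1 / z| ≤ 1 →
        α ≤ 2 * Real.pi * |ξ 0| ∧ |ξ 1| ≤ |ξ 0| := by
      rintro z hz rfl h
      have hz0 : 0 < |2 * Real.pi * ξ 0| := hα.trans_le hz
      rw [abs_div, div_le_one hz0] at h
      rw [abs_mul, abs_of_pos h2π] at hz h
      rw [abs_mul, abs_of_pos h2π] at h
      exact ⟨hz, le_of_mul_le_mul_left h h2π⟩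
    rcases hξ with ⟨h1, h2⟩ | ⟨h1, h2⟩
    · exact key _ (h1.trans (le_abs_self _)) (by simp) (by simpa using h2)
    · exact key _ ((by linarith : α ≤ -((2 * Real.pi) • ξ) 0).trans (neg_le_abs _)) (by simp)
        (by simpa using h2)
  obtain ⟨j, k, hk, h3, h4, h5⟩ := exists_scale_shear hα hα2 hcone.1 hcone.2
  -- The inverse transpose shears by $-k$, and the admissible range is symmetric. One large term is
  -- enough.
  set p : ScaleShear := ⟨(j, -k), by simpa using hk⟩ with hp
  refine le_trans ?_ (ENNReal.le_tsum p)
  have hge := norm_shearletHat_ge h₁ h₂ (x := dualEquiv j (-k) ξ 0) (y := dualEquiv j (-k) ξ 1) hα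
    (by rwa [dualEquiv_apply_zero]) (by rwa [dualEquiv_apply_zero])
    (by rwa [dualEquiv_apply_one, neg_neg])
  rw [ENNReal.ofReal_pow (by positivity), ← ofReal_norm]
  gcongr

theorem isFrameFor_of_enorm_bounds {ι : Type*} {H : Set L2Plane} {σ : ι → L2Plane} {A B : ℝ}
    (hA : 0 < A) (hB : 0 < B)
    (hup : ∀ f ∈ H, ∑' i, ‖inner ℂ f (σ i)‖ₑ ^ 2 ≤ ENNReal.ofReal B * ‖f‖ₑ ^ 2)
    (hlow : ∀ f ∈ H, ENNReal.ofReal A * ‖f‖ₑ ^ 2 ≤ ∑' i, ‖inner ℂ f (σ i)‖ₑ ^ 2) :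
    IsFrameFor H σ := by
  refine ⟨A, B, hA, hB, fun f hf => ?_⟩
  have hfin : ∑' i, ‖inner ℂ f (σ i)‖ₑ ^ 2 ≠ ⊤ := ne_top_of_le_ne_top
    (ENNReal.mul_ne_top ENNReal.ofReal_ne_top (ENNReal.pow_ne_top enorm_ne_top)) (hup f hf)
  have hs : Summable fun i => ‖inner ℂ f (σ i)‖ ^ 2 := by
    simpa using ENNReal.summable_toReal hfin
  have e : ∑' i, ‖inner ℂ f (σ i)‖ₑ ^ 2 = ENNReal.ofReal (∑' i, ‖inner ℂ f (σ i)‖ ^ 2) := by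
    rw [ENNReal.ofReal_tsum_of_nonneg (fun _ => by positivity) hs]
    refine tsum_congr fun i => ?_
    rw [ENNReal.ofReal_pow (norm_nonneg _), ofReal_norm]
  have e' : ∀ D : ℝ, 0 < D → ENNReal.ofReal D * ‖f‖ₑ ^ 2 = ENNReal.ofReal (D * ‖f‖ ^ 2) := by
    intro D hD
    rw [ENNReal.ofReal_mul hD.le, ENNReal.ofReal_pow (norm_nonneg _), ofReal_norm]
  have h1 := hup f hf
  have h2 := hlow f hf
  rw [e, e' B hB] at h1
  rw [e, e' A hA] at h2
  exact ⟨hs, (ENNReal.ofReal_le_ofReal_iff (tsum_nonneg fun _ => by positivity)).1 h2,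
    (ENNReal.ofReal_le_ofReal_iff (by positivity)).1 h1⟩

theorem measurable_enorm_sq_mul (f : L2Plane) {g : ℝ × ℝ → ENNReal} (hg : Measurable g)
    (p : ScaleShear) : Measurable fun ξ : Plane => ‖(𝓕 f : L2Plane) ξ‖ₑ ^ 2
      * g (dualEquiv p.1.1 p.1.2 ξ 0, dualEquiv p.1.1 p.1.2 ξ 1) :=
  ((Lp.stronglyMeasurable (𝓕 f : L2Plane)).measurable.enorm.pow_const 2).mul
    (measurable_comp_dualEquiv _ _ hg)

theorem enorm_fourier (f : L2Plane) : ‖(𝓕 f : L2Plane)‖ₑ = ‖f‖ₑ := by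
  rw [← ofReal_norm, ← ofReal_norm, Lp.norm_fourier_eq]

theorem tsum_lintegral_envelope_le {K : ℝ} (hK : ∀ ξ : Plane, ∑' p : ScaleShear,
      ENNReal.ofReal (envelope (dualEquiv p.1.1 p.1.2 ξ 0) (dualEquiv p.1.1 p.1.2 ξ 1))
        ≤ ENNReal.ofReal K) (f : L2Plane) :
    ∑' p : ScaleShear, ∫⁻ ξ, ‖(𝓕 f : L2Plane) ξ‖ₑ ^ 2
        * ENNReal.ofReal (envelope (dualEquiv p.1.1 p.1.2 ξ 0) (dualEquiv p.1.1 p.1.2 ξ 1))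
      ≤ ENNReal.ofReal K * ‖f‖ₑ ^ 2 := by
  rw [← lintegral_tsum fun p => (measurable_enorm_sq_mul f
    measurable_envelope.ennreal_ofReal p).aemeasurable]
  calc _ ≤ ∫⁻ ξ, ENNReal.ofReal K * ‖(𝓕 f : L2Plane) ξ‖ₑ ^ 2 := by
        refine lintegral_mono fun ξ => ?_
        simp only
        rw [ENNReal.tsum_mul_left, mul_comm]
        exact mul_le_mul_left (hK ξ) _
    _ = _ := by
        rw [lintegral_const_mul' _ _ ENNReal.ofReal_ne_top, lintegral_enorm_sq, enorm_fourier]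

/-- Outside the cones $\hat f$ vanishes almost everywhere, so the pointwise lower bound is needed
only on them. The factor $2\pi$ converts between the two normalizations. -/
theorem le_tsum_lintegral_of_mem_coneSpace {A α : ℝ} {G : ℝ → ℝ → ℂ}
    (hGm : Measurable fun p : ℝ × ℝ => G p.1 p.2)
    (hA : ∀ ξ : Plane, (2 * Real.pi) • ξ ∈ horizontalCones α →
      ENNReal.ofReal A ≤ ∑' p : ScaleShear,
        ‖G (dualEquiv p.1.1 p.1.2 ξ 0) (dualEquiv p.1.1 p.1.2 ξ 1)‖ₑ ^ 2) {f : L2Plane}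
    (hf : f ∈ coneSpace α) :
    ENNReal.ofReal A * ‖f‖ₑ ^ 2 ≤ ∑' p : ScaleShear, ∫⁻ ξ, ‖(𝓕 f : L2Plane) ξ‖ₑ ^ 2
        * ‖G (dualEquiv p.1.1 p.1.2 ξ 0) (dualEquiv p.1.1 p.1.2 ξ 1)‖ₑ ^ 2 := by
  have h2π : 2 * Real.pi ≠ 0 := by positivity
  rw [← lintegral_tsum fun p => (measurable_enorm_sq_mul f
    (g := fun q => ‖G q.1 q.2‖ₑ ^ 2) (hGm.enorm.pow_const 2) p).aemeasurable, ← enorm_fourier,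
    ← lintegral_enorm_sq, ← lintegral_const_mul' _ _ ENNReal.ofReal_ne_top]
  refine lintegral_mono_ae ?_
  filter_upwards [(quasiMeasurePreserving_smul h2π).ae hf] with ξ hξ
  rw [ENNReal.tsum_mul_left, mul_comm]
  by_cases hc : (2 * Real.pi) • ξ ∈ horizontalCones α
  · exact mul_le_mul_right (hA ξ hc) _
  · have h0 := hξ hc
    rw [hat, inv_smul_smul₀ h2π] at h0
    simp [h0]

end Frame

/-! ### The frame bounds and the conclusion. -/

theorem exists_isFrameFor {N₁ l₁ N₂ l₂ : ℕ} {a₁ a₂ : ℤ →₀ ℝ}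
    (h₁ : IsTypeIMask N₁ l₁ a₁) (h₂ : IsTypeIMask N₂ l₂ a₂)
    (hN₁ : 3 ≤ N₁) (hl₂ : l₂ < N₂) (hN₂ : 3 ≤ N₂) {ψ : L2Plane} (hψ : IsShearlet a₁ a₂ ψ) {α : ℝ}
    (hα : 0 < α) (hα2 : α ≤ Real.pi) :
    ∃ c : ℝ, 0 < c ∧ ∀ c₁ c₂ : ℝ, 0 < c₁ → c₁ ≤ c → 0 < c₂ → c₂ ≤ c →
      IsFrameFor (coneSpace α) (shearletSystem ψ c₁ c₂) := by
  have hGm := measurable_shearletHat (a₁ := a₁) h₂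
  have hψ' := (isShearlet_iff ψ).1 hψ
  obtain ⟨C, hC, hG⟩ := exists_norm_shearletHat_le h₁ h₂ hN₁ hl₂ hN₂
  obtain ⟨K, hK, hKG⟩ := exists_tsum_translates_le hC hG
  obtain ⟨E, hE, hKE⟩ := exists_tsum_envelope_dualEquiv_le
  obtain ⟨A, hA, hAG⟩ := exists_le_tsum_shearletHat h₁ h₂ hα hα2
  -- Chosen so that the total off-diagonal contribution, with relative size $2K\theta E$, is exactly
  -- half of the diagonal bound $A$. Since sparsity gains only $c^{1/8}$, the threshold for $c$ is
  -- $\theta^8$.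
  set θ : ℝ := A / (4 * K * E) with hθ
  have hθ0 : 0 < θ := by positivity
  refine ⟨min 1 (θ ^ 8), by positivity, fun c₁ c₂ hc₁ hc₁' hc₂ hc₂' => ?_⟩
  set c : ℝ := min 1 (θ ^ 8) with hc
  have hc0 : 0 < c := by positivity
  have hcθ : c ^ (1 / 8 : ℝ) ≤ θ := by
    calc c ^ (1 / 8 : ℝ) ≤ (θ ^ 8) ^ (1 / 8 : ℝ) :=
          Real.rpow_le_rpow hc0.le (min_le_right _ _) (by norm_num)
      _ = θ := by
        rw [← Real.rpow_natCast, ← Real.rpow_mul hθ0.le]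
        norm_num
  have hbounds := hKG c c₁ c₂ (min_le_left _ _) hc₁ hc₁' hc₂ hc₂'
  have hK1 := fun x y => (hbounds x y).1
  have hK2 : ∀ x y, ‖shearletHat a₁ a₂ x y‖ₑ * ∑' n : Fin 2 → ℤ, (if n = 0 then 0 else 1)
        * ‖shearletHat a₁ a₂ (x + n 0 / c₁) (y + n 1 / c₂)‖ₑ
      ≤ ENNReal.ofReal (K * θ) * ENNReal.ofReal (envelope x y) := fun x y =>
    (hbounds x y).2.trans (mul_le_mul_left (ENNReal.ofReal_le_ofReal (by gcongr)) _)
  set κ : ℝ := 1 / (c₁ * c₂) with hκ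
  have hκ0 : 0 < κ := by positivity
  have hsplit : ∀ x : ℝ, 0 ≤ x → ENNReal.ofReal (κ * (2 * x) * E)
      = ENNReal.ofReal κ * (2 * ENNReal.ofReal x) * ENNReal.ofReal E := by
    intro x hx
    rw [ENNReal.ofReal_mul (by positivity), ENNReal.ofReal_mul (by positivity),
      ENNReal.ofReal_mul two_pos.le, ENNReal.ofReal_ofNat]
  refine isFrameFor_of_enorm_bounds (A := κ * (A / 2)) (B := κ * (2 * K) * E) (by positivity)
    (by positivity) (fun f hf => ?_) (fun f hf => ?_)
  · rw [tsum_shearIndex]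
    calc _ ≤ ∑' p : ScaleShear, ENNReal.ofReal κ * (2 * ENNReal.ofReal K)
          * ∫⁻ ξ, ‖(𝓕 f : L2Plane) ξ‖ₑ ^ 2
          * ENNReal.ofReal (envelope (dualEquiv p.1.1 p.1.2 ξ 0) (dualEquiv p.1.1 p.1.2 ξ 1)) :=
          ENNReal.tsum_le_tsum fun p =>
            tsum_inner_shearletFun_le p.1.1 p.1.2 hc₁ hc₂ hGm f ψ hψ' hK1
      _ ≤ ENNReal.ofReal κ * (2 * ENNReal.ofReal K) * (ENNReal.ofReal E * ‖f‖ₑ ^ 2) := by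
          rw [ENNReal.tsum_mul_left]
          exact mul_le_mul_right (tsum_lintegral_envelope_le hKE f) _
      _ = _ := by rw [hsplit K hK.le, mul_assoc _ (ENNReal.ofReal E)]
  · rw [tsum_shearIndex]
    set S := ∑' p : ScaleShear, ∑' m : ℤ × ℤ,
      ‖inner ℂ f ((memLp_shearletFun ψ c₁ c₂ p.1.1 p.1.2 m).toLp _)‖ₑ ^ 2 with hS
    have hfull : ENNReal.ofReal (κ * A) * ‖f‖ₑ ^ 2
        ≤ S + ENNReal.ofReal (κ * (A / 2)) * ‖f‖ₑ ^ 2 := by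
      calc _ = ENNReal.ofReal κ * (ENNReal.ofReal A * ‖f‖ₑ ^ 2) := by
            rw [ENNReal.ofReal_mul hκ0.le, mul_assoc]
        _ ≤ ENNReal.ofReal κ * ∑' p : ScaleShear, ∫⁻ ξ, ‖(𝓕 f : L2Plane) ξ‖ₑ ^ 2
            * ‖shearletHat a₁ a₂ (dualEquiv p.1.1 p.1.2 ξ 0) (dualEquiv p.1.1 p.1.2 ξ 1)‖ₑ ^ 2 :=
          mul_le_mul_right (le_tsum_lintegral_of_mem_coneSpace hGm hAG hf) _
        _ ≤ S + ∑' p : ScaleShear, ENNReal.ofReal κ * (2 * ENNReal.ofReal (K * θ))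
            * ∫⁻ ξ, ‖(𝓕 f : L2Plane) ξ‖ₑ ^ 2
            * ENNReal.ofReal (envelope (dualEquiv p.1.1 p.1.2 ξ 0) (dualEquiv p.1.1 p.1.2 ξ 1)) := by
          rw [← ENNReal.tsum_mul_left, hS, ← ENNReal.tsum_add]
          exact ENNReal.tsum_le_tsum fun p =>
            lintegral_le_tsum_inner_shearletFun p.1.1 p.1.2 hc₁ hc₂ hGm f ψ hψ' hK1 hK2
        _ ≤ S + ENNReal.ofReal κ * (2 * ENNReal.ofReal (K * θ)) * (ENNReal.ofReal E * ‖f‖ₑ ^ 2) := by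
          rw [ENNReal.tsum_mul_left]
          exact add_le_add_right (mul_le_mul_right (tsum_lintegral_envelope_le hKE f) _) _
        _ = _ := by
          have e : κ * (A / 2) = κ * (2 * (K * θ)) * E := by
            rw [hθ]
            field_simp
            ring
          rw [e, hsplit (K * θ) (by positivity), mul_assoc _ (ENNReal.ofReal E)]
    have e : ENNReal.ofReal (κ * A) * ‖f‖ₑ ^ 2
        = ENNReal.ofReal (κ * (A / 2)) * ‖f‖ₑ ^ 2 + ENNReal.ofReal (κ * (A / 2)) * ‖f‖ₑ ^ 2 := by
      rw [← add_mul, ← ENNReal.ofReal_add (by positivity) (by positivity)]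
      congr 2
      ring
    rw [e] at hfull
    -- Half of the diagonal bound is absorbed; the cancellation is legitimate because this half is
    -- finite.
    exact (ENNReal.add_le_add_iff_right (ENNReal.mul_ne_top ENNReal.ofReal_ne_top
      (ENNReal.pow_ne_top enorm_ne_top))).1 hfull

end Shearlet

end

theorem mainTheorem4 (N₁ l₁ N₂ l₂ : ℕ) (hl₁ : l₁ < N₁) (hl₂ : l₂ < N₂)
    (hzero : l₂ = 0 → 3 < N₂ ∧ N₂ < N₁)
    (hpos : 0 < l₂ → 8 < N₂ ∧ N₂ ≤ N₁)
    (a₁ a₂ : ℤ →₀ ℝ)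
    (ha₁ : Shearlet.IsTypeIMask N₁ l₁ a₁) (ha₂ : Shearlet.IsTypeIMask N₂ l₂ a₂) :
    (∃! ψ : Shearlet.L2Plane, Shearlet.IsShearlet a₁ a₂ ψ) ∧
    ∀ ψ : Shearlet.L2Plane, Shearlet.IsShearlet a₁ a₂ ψ →
      ∀ α : ℝ, 0 < α → α < Real.pi / 2 →
        ∃ c : ℝ, 0 < c ∧ ∀ c₁ c₂ : ℝ, 0 < c₂ → c₂ ≤ c₁ → c₁ ≤ c →
          Shearlet.IsFrameFor (Shearlet.coneSpace α) (Shearlet.shearletSystem ψ c₁ c₂) := by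
  -- Order at least $3$ gives the decay exponent $5/4$ of $\hat\phi$ and the cubic zero of $\hat b$.
  have hN : 3 ≤ N₂ ∧ 3 ≤ N₁ := by
    rcases Nat.eq_zero_or_pos l₂ with h | h
    · have := hzero h
      omega
    · have := hpos h
      omega
  refine ⟨Shearlet.existsUnique_isShearlet ha₁ ha₂ hN.2 hl₂ hN.1, fun ψ hψ α hα hα2 => ?_⟩
  obtain ⟨c, hc, h⟩ := Shearlet.exists_isFrameFor ha₁ ha₂ hN.2 hl₂ hN.1 hψ hα
    (by linarith [Real.pi_pos])
  exact ⟨c, hc, fun c₁ c₂ h2 h21 h1 => h c₁ c₂ (h2.trans_le h21) h1 h2 (h21.trans h1)⟩
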